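/- Let $0<\alpha<1$ be irrational and let $\Omega_\alpha\subset\{0,1\}^{\mathbb Z}$ be the Sturmian subshift, i.e. the closure of the set of sequences $(I_\alpha(t+n\alpha \bmod 1))_{n\in\mathbb Z}$, $t\in[0,1)$, where $I_\alpha=0$ on $[0,1-\alpha)$ and $I_\alpha=1$ on $[1-\alpha,1)$, with the shift $\sigma$. Let $(d_k)_{k\ge1}$ be positive integers and let $B$ be a properly ordered Bratteli diagram (there are a unique maximal and a unique minimal infinite path) of the following form: $V_0=\{v_0\}$; $V_n=\{1,2\}$ for $n\ge1$; there is one edge from $v_0$ to each vertex of $V_1$; for $k\ge1$ the incidence matrix between $V_k$ and $V_{k+1}$ is $\begin{pmatrix} d_k&1\\1&0\end{pmatrix}$ (rows indexed by $V_k$, columns by $V_{k+1}$), and the edge from $2\in V_k$ to $1\in V_{k+1}$ may have any position in the order of the $d_k+1$ edges ending at $1\in V_{k+1}$. Assume that the Bratteli–Vershik system $(X_B,V_B)$ is topologically conjugate to $(\Omega_\alpha,\sigma)$; the Dartnell–Durand–Maass representation of $\Omega_\alpha$ is of this kind. Let $\mu$ be a $V_B$-invariant Borel probability measure on $X_B$.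 Let $p_k/q_k=[0:d_1,\dots,d_k]$, $\beta=[0:d_1,d_2,\dots]=\lim_k p_k/q_k$, and let $G(x)=\{1/x\}$ be the Gauss map. Let $x=(x_1,x_2,\dots)\in X_B$, and let $I_n=[x_1\dots x_n]$ be the cylinder of all paths whose first $n$ edges are $x_1,\dots,x_n$. For $y\in X_B$ put $N_n(y)=\inf\{m>0: V_B^m(y)\in I_n\}$ and $F_n(t)=\mu\{y\in X_B:\mu(I_n)N_n(y)\le t\}$. Let $\mathcal M$ be an infinite set of integers $n\ge 1$ such that $x_n$ ends at the vertex $1$ for all $n\in\mathcal M$, and suppose that $$\lim_{n\to\infty,\,n\in\mathcal M}\frac{q_{n-3}}{q_{n-2}}=w,\qquad \lim_{n\to\infty,\,n\in\mathcal M}G^{n-2}(\beta)=\theta>0 .$$ Put $$h_1=\frac{(\lfloor 1/\theta\rfloor+w)\,\theta}{1+\theta w},\qquad h_2=\frac{(1+\lfloor 1/\theta\rfloor+w)\,\theta}{1+\theta w}.$$ Then $0<h_1\le1\le h_2$ and $h_1<h_2$, and for every $t\in\mathbb R$ the limit $F(t)=\lim_{n\to\infty,\,n\in\mathcal M}F_n(t)$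 exists and is the continuous piecewise linear function with $$F(t)=0\ (t\le0),\quad F(t)=t\ (0\le t\le h_1),\quad F(t)=h_1+\frac{(1-h_1)(t-h_1)}{h_2-h_1}\ (h_1\le t\le h_2),\quad F(t)=1\ (t\ge h_2).$$ If moreover $1/\theta$ is not an integer $\ge2$, then $h_1=\lim_{n\in\mathcal M}(p_{n-1}+q_{n-1})\,\mu(I_n)$ and $h_2=\lim_{n\in\mathcal M}(p_{n-1}+q_{n-1}+p_{n-2}+q_{n-2})\,\mu(I_n)$. -/

import Mathlib

open Filter Topology MeasureTheory

noncomputable section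

/-- An ordered Bratteli diagram. `V n` is the set of vertices of level `n`. The edges of `E_{n+1}`
that end at `v ∈ V (n+1)` form a finite linearly ordered set; they are listed in increasing order
by `Fin (deg n v)`, and `src n v i` is the starting vertex in `V n` of the `i`-th of them. -/
structure OrderedBratteliDiagram where
  V : ℕ → Type
  deg : (n : ℕ) → V (n + 1) → ℕ
  src : (n : ℕ) → (v : V (n + 1)) → Fin (deg n v) → V n
  finite_V : ∀ n, Finite (V n)
  exists_root : ∃ v₀ : V 0, ∀ v, v = v₀
  deg_pos : ∀ n v, 0 < deg n v
  exists_out : ∀ n (u : V n), ∃ v i, src n v i = u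

namespace OrderedBratteliDiagram

/-- The edge set `E_{n+1}` between `V n` and `V (n+1)`. -/
@[ext]
structure Edge (B : OrderedBratteliDiagram) (n : ℕ) where
  tgt : B.V (n + 1)
  idx : Fin (B.deg n tgt)

variable {B : OrderedBratteliDiagram}

instance (n : ℕ) : TopologicalSpace (B.Edge n) := ⊥

/-- The starting vertex of an edge. -/
def Edge.source {n : ℕ} (e : B.Edge n) : B.V n := B.src n e.tgt e.idx

/-- No edge with the same end-point is larger. -/
def Edge.IsMaximal {n : ℕ} (e : B.Edge n) : Prop := (e.idx : ℕ) + 1 = B.deg n e.tgt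

/-- No edge with the same end-point is smaller. -/
def Edge.IsMinimal {n : ℕ} (e : B.Edge n) : Prop := (e.idx : ℕ) = 0

/-- The minimal edge ending at `v`. -/
def minEdge (n : ℕ) (v : B.V (n + 1)) : B.Edge n := ⟨v, ⟨0, B.deg_pos n v⟩⟩

/-- The successor of a non-maximal edge. -/
def Edge.succ {n : ℕ} (e : B.Edge n) (h : ¬ e.IsMaximal) : B.Edge n :=
  ⟨e.tgt, ⟨(e.idx : ℕ) + 1, lt_of_le_of_ne e.idx.isLt h⟩⟩

variable (B) in
/-- The space `X_B` of infinite paths `(e₁, e₂, …)` from the root; `x.1 n` is the edge `e_{n+1}`. -/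
def PathSpace : Type :=
  {x : (n : ℕ) → B.Edge n // ∀ n, (x n).tgt = (x (n + 1)).source}

/-- The topology generated by the cylinder sets. -/
instance : TopologicalSpace B.PathSpace :=
  inferInstanceAs (TopologicalSpace {x : (n : ℕ) → B.Edge n // ∀ n, (x n).tgt = (x (n + 1)).source})

instance : MeasurableSpace B.PathSpace := borel _

instance : BorelSpace B.PathSpace := ⟨rfl⟩

/-- The cylinder `[x₁, …, x_n]`. -/
def cylinder (x : B.PathSpace) (n : ℕ) : Set B.PathSpace := {y | ∀ i < n, y.1 i = x.1 i}

def IsMaxPath (x : B.PathSpace) : Prop := ∀ n, (x.1 n).IsMaximal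

def IsMinPath (x : B.PathSpace) : Prop := ∀ n, (x.1 n).IsMinimal

variable (B) in
/-- There are a unique maximal and a unique minimal infinite path. -/
def IsProperlyOrdered : Prop := (∃! x : B.PathSpace, IsMaxPath x) ∧ ∃! x : B.PathSpace, IsMinPath x

/-- Replace the edges with index `k - 1, k - 2, …, 0`, in this order, by the minimal edge that ends
at the starting vertex of the edge above it: the edges below index `k` become the minimal path from
the root to the starting vertex of `x k`. -/
def fillMin : ℕ → ((n : ℕ) → B.Edge n) → (n : ℕ) → B.Edge n
  | 0, x => x
  | k + 1, x => fillMin k (Function.update x k (minEdge k (x (k + 1)).source))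

theorem fillMin_compatible (k : ℕ) (x : (n : ℕ) → B.Edge n)
    (hx : ∀ n, k ≤ n → (x n).tgt = (x (n + 1)).source) (n : ℕ) :
    (fillMin k x n).tgt = (fillMin k x (n + 1)).source := by
  induction k generalizing x with
  | zero => exact hx n n.zero_le
  | succ k ih =>
    refine ih _ fun m hm => ?_
    rw [Function.update_of_ne (show m + 1 ≠ k by omega)]
    rcases hm.eq_or_lt with rfl | h
    · rw [Function.update_self]; rfl
    · rw [Function.update_of_ne h.ne']
      exact hx m h

open Classical in
/-- The Vershik map. If `k` is the least index at which the edge of `x` is not maximal, this edge is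
replaced by its successor and the edges below by the minimal path to the starting vertex of that
successor. A maximal path is sent to a minimal path (to `x_max ↦ x_min` if `B` is properly ordered;
the last branch never occurs then). -/
def vershik (x : B.PathSpace) : B.PathSpace :=
  if h : ∃ k, ¬ (x.1 k).IsMaximal then
    ⟨fillMin (Nat.find h)
        (Function.update x.1 (Nat.find h) ((x.1 (Nat.find h)).succ (Nat.find_spec h))), by
      refine fillMin_compatible _ _ fun n hn => ?_
      rw [Function.update_of_ne (show n + 1 ≠ Nat.find h by omega), ← x.2 n]
      rcases hn.eq_or_lt with rfl | h'
      · rw [Function.update_self]; rfl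
      · rw [Function.update_of_ne h'.ne']⟩
  else if h' : ∃ y : B.PathSpace, IsMinPath y then h'.choose
  else x

end OrderedBratteliDiagram

/-- The entrance time `N_I^{(1)}(x) = inf {n > 0 : Tⁿ x ∈ I}` (a set that is non-empty when the
system is minimal and `I` is open and non-empty). -/
def entranceTime {X : Type*} (T : X → X) (I : Set X) (x : X) : ℕ :=
  sInf {n : ℕ | 0 < n ∧ T^[n] x ∈ I}

/-- The distribution `F_I^{(1)}(t) = μ {x : μ(I) N_I^{(1)}(x) ≤ t}`. -/
def entranceLaw {X : Type*} [MeasurableSpace X] (μ : Measure X) (T : X → X) (I : Set X) (t : ℝ) :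
    ℝ :=
  μ.real {x | μ.real I * (entranceTime T I x : ℝ) ≤ t}

/-- The coding `I_α` of `[0,1[`: `0` (`false`) on `[0, 1 - α[` and `1` (`true`) otherwise. -/
def rotationCode (α t : ℝ) : Bool := decide (1 - α ≤ t)

/-- The Sturmian subshift `Ω_α`: the closure of the set of codings `(I_α (R_αⁿ t))_{n ∈ ℤ}`,
`t ∈ [0,1[`, where `R_αⁿ t = t + n α (mod 1)`. -/
def sturmianSubshift (α : ℝ) : Set (ℤ → Bool) :=
  closure {x | ∃ t ∈ Set.Ico (0 : ℝ) 1, x = fun n : ℤ => rotationCode α (Int.fract (t + n * α))}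

/-- The Bratteli–Vershik system of `B` is topologically conjugate to the Sturmian subshift `Ω_α`
with the shift. -/
def OrderedBratteliDiagram.RepresentsSturmian (B : OrderedBratteliDiagram) (α : ℝ) : Prop :=
  ∃ φ : B.PathSpace ≃ₜ sturmianSubshift α,
    ∀ (x : B.PathSpace) (n : ℤ), (φ (vershik x)).1 n = (φ x).1 (n + 1)

/-- The two vertices `1`, `2` of each level `n ≥ 1`. -/
inductive TwoVertices : Type
  | one
  | two

def SturmianVertex : ℕ → Type
  | 0 => Unit
  | _ + 1 => TwoVertices

/-- The number of edges that end at a vertex: one at level `1`; at level `k + 1` with `k ≥ 1` there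
are `d k + 1` at the vertex `1` and one at the vertex `2`. -/
def sturmianDeg (d : ℕ → ℕ) : (n : ℕ) → SturmianVertex (n + 1) → ℕ
  | 0, _ => 1
  | k + 1, TwoVertices.one => d (k + 1) + 1
  | _ + 1, TwoVertices.two => 1

/-- For `k ≥ 1`, of the `d k + 1` ordered edges from level `k` to the vertex `1` of level `k + 1` the
one in position `pos k` starts at the vertex `2`, and the other `d k` start at the vertex `1`; the
edge to the vertex `2` of level `k + 1` starts at the vertex `1`. -/
def sturmianSrc (d pos : ℕ → ℕ) :
    (n : ℕ) → (v : SturmianVertex (n + 1)) → Fin (sturmianDeg d n v) → SturmianVertex n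
  | 0, _, _ => ()
  | k + 1, TwoVertices.one, i => if (i : ℕ) = pos (k + 1) then TwoVertices.two else TwoVertices.one
  | _ + 1, TwoVertices.two, _ => TwoVertices.one

/-- The ordered Bratteli diagram with one edge from the root to each of the two vertices of level `1`
and, for `k ≥ 1`, incidence matrix `!![d k, 1; 1, 0]` between the levels `k` and `k + 1`, in which the
edge from the vertex `2` to the vertex `1` of the next level has position `pos k ∈ {0, …, d k}` among
the edges ending there. The value `pos k = 0` puts this edge first and `pos k = d k` puts it last. -/
def sturmianDiagram (d pos : ℕ → ℕ) (hpos : ∀ k, 1 ≤ k → pos k ≤ d k) : OrderedBratteliDiagram where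
  V := SturmianVertex
  deg := sturmianDeg d
  src := sturmianSrc d pos
  finite_V
    | 0 => inferInstanceAs (Finite Unit)
    | _ + 1 => Set.finite_univ_iff.mp <|
        (Set.toFinite {TwoVertices.one, TwoVertices.two}).subset fun v _ => by
          cases v <;> simp
  exists_root := ⟨(), fun _ => rfl⟩
  deg_pos
    | 0, _ => Nat.one_pos
    | _ + 1, TwoVertices.one => Nat.succ_pos _
    | _ + 1, TwoVertices.two => Nat.one_pos
  exists_out
    | 0, _ => ⟨TwoVertices.one, ⟨0, Nat.one_pos⟩, rfl⟩
    | _ + 1, TwoVertices.one => ⟨TwoVertices.two, ⟨0, Nat.one_pos⟩, rfl⟩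
    | k + 1, TwoVertices.two =>
        ⟨TwoVertices.one, ⟨pos (k + 1), Nat.lt_succ_of_le (hpos _ (Nat.succ_pos k))⟩, if_pos rfl⟩

/-- The terminal vertex `t(x_n)` of the `n`-th edge of a path, `n ≥ 1`. -/
def sturmianTerminal {d pos : ℕ → ℕ} {hpos : ∀ k, 1 ≤ k → pos k ≤ d k}
    (x : (sturmianDiagram d pos hpos).PathSpace) (n : ℕ) : TwoVertices :=
  (x.1 (n - 1)).tgt

/-- The numerator `p_k` of `[0 : d 1, …, d k]`. -/
def cfNum (d : ℕ → ℕ) : ℕ → ℕ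
  | 0 => 0
  | 1 => 1
  | k + 2 => d (k + 2) * cfNum d (k + 1) + cfNum d k

/-- The denominator `q_k` of `[0 : d 1, …, d k]`. -/
def cfDen (d : ℕ → ℕ) : ℕ → ℕ
  | 0 => 1
  | 1 => d 1
  | k + 2 => d (k + 2) * cfDen d (k + 1) + cfDen d k

/-- The Gauss map. -/
def gaussMap (x : ℝ) : ℝ := Int.fract (1 / x)

/-- The piecewise linear function that is `0` on `]-∞, 0]`, interpolates linearly between the points
`(0, 0)`, `(h₁, h₁)`, `(h₂, 1)`, and is `1` on `[h₂, ∞[`. -/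
def piecewiseLinearLaw (h₁ h₂ t : ℝ) : ℝ :=
  if t ≤ 0 then 0
  else if t ≤ h₁ then t
  else if t ≤ h₂ then h₁ + (1 - h₁) * (t - h₁) / (h₂ - h₁)
  else 1

end

/-! The end-point of the first `n` edges splits `X_B` into two towers, over the vertices `1` and
`2`, whose levels are the cylinders of length `n`. The Vershik map climbs one level, or jumps from a
top to a bottom. Let `x_n` end at `1`. Then `I = I_n` is a level of the first tower. A single edge
leaves each vertex `2`, so the second tower is never crossed twice in a row. Hence the return time
to `I` is `p = p_{n-1} + q_{n-1}`, or `p + q` with `q = p_{n-2} + q_{n-2}` on the set `D ⊆ I` of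
points whose next tower is the second one. By invariance, `{N = j + 1} = T⁻¹({N = j} \ I)` gives `{N
= j}` mass `μ(I)` for `1 ≤ j ≤ p` and `μ(D)` for `p < j ≤ p + q`. So `F_n` is a discretised concave
function with slopes `1`, `ρ_n = μ(D)/μ(I)` and `0` (`entranceLaw_eq_min`,
`entranceLaw_towerLevel`).

Let `a k` be the mass of a cylinder ending at vertex `1` of level `k + 1`. Total mass one on
consecutive levels yields `a k = d (k+1) * a (k+1) + a (k+2)`, so `β = a 1 / a 0` and `G^k β = a
(k+1) / a k`. With `μ(I) = a (n-1)` and `μ(D) = a n`, the slope `ρ_n` is the fractional part of `1 /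
G^{n-2} β`. Moreover `B_n = q μ(I)` tends to `θ / (1 + θ w)`, and the first break is at `1 - ρ_n
B_n`.

The limit follows by continuity unless `1/θ` is an integer. Then `ρ_n` may accumulate at both `0`
and `1`, but either way the law tends to `min t 1`, with an error of at most `ρ_n (1 - ρ_n) B_n`
(`tendsto_min_law`). The breaks themselves converge only if `ρ_n` does, whence the extra condition;
`1/θ = 1` is harmless because it is approached from the right. -/

/-! ### Towers of an ordered Bratteli diagram and the Vershik map -/

namespace OrderedBratteliDiagram

variable {B : OrderedBratteliDiagram}

variable (B) in
/-- The number of paths from the root to a vertex. -/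
def towerHeight : (n : ℕ) → B.V n → ℕ
  | 0, _ => 1
  | n + 1, v => ∑ i : Fin (B.deg n v), towerHeight n (B.src n v i)

/-- The number of paths to the end-point of `e` whose last edge is smaller than `e`. -/
def Edge.offset {n : ℕ} (e : B.Edge n) : ℕ :=
  ∑ i ∈ Finset.Iio e.idx, B.towerHeight n (B.src n e.tgt i)

/-- The vertex of level `n` on a path. -/
def vertex (n : ℕ) (y : B.PathSpace) : B.V n := (y.1 n).source

/-- The number of predecessors of the initial segment of length `n` of a path among the paths with
the same end-point. -/
def rank : ℕ → B.PathSpace → ℕ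
  | 0, _ => 0
  | n + 1, y => rank n y + (y.1 n).offset

/-- The level `j` of the tower over the vertex `v` of level `n`. -/
def towerLevel (n : ℕ) (v : B.V n) (j : ℕ) : Set B.PathSpace :=
  {y | vertex n y = v ∧ rank n y = j}

theorem vertex_succ (n : ℕ) (y : B.PathSpace) : vertex (n + 1) y = (y.1 n).tgt := (y.2 n).symm

theorem towerHeight_pos (n : ℕ) (v : B.V n) : 0 < B.towerHeight n v := by
  induction n with
  | zero => exact Nat.one_pos
  | succ n ih => exact Finset.sum_pos (fun i _ => ih _) ⟨⟨0, B.deg_pos n v⟩, Finset.mem_univ _⟩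

theorem Edge.offset_add_eq_sum {n : ℕ} (e : B.Edge n) :
    e.offset + B.towerHeight n e.source =
      ∑ i ∈ Finset.Iic e.idx, B.towerHeight n (B.src n e.tgt i) := by
  rw [← Finset.Iio_insert, Finset.sum_insert (by simp), add_comm]
  rfl

theorem Edge.offset_add_le {n : ℕ} (e : B.Edge n) :
    e.offset + B.towerHeight n e.source ≤ B.towerHeight (n + 1) e.tgt := by
  rw [e.offset_add_eq_sum]
  exact Finset.sum_le_sum_of_subset (Finset.subset_univ _)

theorem Edge.IsMaximal.offset_add {n : ℕ} {e : B.Edge n} (h : e.IsMaximal) :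
    e.offset + B.towerHeight n e.source = B.towerHeight (n + 1) e.tgt := by
  rw [e.offset_add_eq_sum]
  refine Finset.sum_congr (Finset.eq_univ_iff_forall.2 fun i => ?_) fun _ _ => rfl
  rw [Finset.mem_Iic, Fin.le_def]
  have := i.isLt
  unfold Edge.IsMaximal at h
  omega

theorem Edge.IsMinimal.offset_eq {n : ℕ} {e : B.Edge n} (h : e.IsMinimal) : e.offset = 0 := by
  refine Finset.sum_eq_zero fun i hi => ?_
  rw [Finset.mem_Iio, Fin.lt_def] at hi
  unfold Edge.IsMinimal at h
  omega

theorem Edge.offset_succ {n : ℕ} (e : B.Edge n) (h : ¬ e.IsMaximal) :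
    (e.succ h).offset = e.offset + B.towerHeight n e.source := by
  rw [e.offset_add_eq_sum]
  obtain ⟨v, i⟩ := e
  have hi : (i : ℕ) + 1 < B.deg n v := lt_of_le_of_ne i.isLt h
  change ∑ k ∈ Finset.Iio (⟨i + 1, hi⟩ : Fin (B.deg n v)), _ = ∑ k ∈ Finset.Iic i, _
  refine Finset.sum_congr (Finset.ext fun k => ?_) fun _ _ => rfl
  simp only [Finset.mem_Iio, Finset.mem_Iic, Fin.lt_def, Fin.le_def]
  omega

theorem offset_add_le_offset {n : ℕ} {v : B.V (n + 1)} {i j : Fin (B.deg n v)} (h : i < j) :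
    (⟨v, i⟩ : B.Edge n).offset + B.towerHeight n (B.src n v i) ≤ (⟨v, j⟩ : B.Edge n).offset := by
  rw [show B.src n v i = (⟨v, i⟩ : B.Edge n).source from rfl, Edge.offset_add_eq_sum]
  refine Finset.sum_le_sum_of_subset fun k hk => ?_
  rw [Finset.mem_Iic] at hk
  exact Finset.mem_Iio.2 (hk.trans_lt h)

theorem rank_lt (n : ℕ) (y : B.PathSpace) : rank n y < B.towerHeight n (vertex n y) := by
  induction n with
  | zero => exact Nat.one_pos
  | succ n ih =>
    rw [vertex_succ]
    have := (y.1 n).offset_add_le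
    simp only [rank, vertex] at *
    omega

theorem rank_add_one_of_isMaximal {n : ℕ} {y : B.PathSpace} (h : ∀ i < n, (y.1 i).IsMaximal) :
    rank n y + 1 = B.towerHeight n (vertex n y) := by
  induction n with
  | zero => rfl
  | succ n ih =>
    have h1 := ih fun i hi => h i (by omega)
    have h2 := (h n (by omega)).offset_add
    rw [vertex_succ]
    simp only [rank, vertex] at *
    omega

theorem rank_eq_zero_of_isMinimal {n : ℕ} {y : B.PathSpace} (h : ∀ i < n, (y.1 i).IsMinimal) :
    rank n y = 0 := by
  induction n with
  | zero => rfl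
  | succ n ih =>
    rw [rank, ih fun i hi => h i (by omega), (h n (by omega)).offset_eq]

/-- Over the edges with a common end-point, the intervals that start at the offset and have the
height of the source as length are pairwise disjoint. -/
theorem edge_eq_of_add_offset_eq {n : ℕ} {e f : B.Edge n} (h : e.tgt = f.tgt) {i j : ℕ}
    (hi : i < B.towerHeight n e.source) (hj : j < B.towerHeight n f.source)
    (hij : i + e.offset = j + f.offset) : e = f := by
  obtain ⟨v, k⟩ := e
  obtain ⟨v', l⟩ := f
  obtain rfl : v = v' := h
  simp only [Edge.source] at hi hj
  rcases lt_trichotomy k l with h | h | h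
  · have := offset_add_le_offset h; omega
  · rw [h]
  · have := offset_add_le_offset h; omega

/-- The rank acts as a mixed-radix expansion: the last edge is read off first, then the remaining
rank determines the edges below. Thus tower levels are cylinders. -/
theorem eq_of_rank_eq {n : ℕ} {y z : B.PathSpace} (hv : vertex n y = vertex n z)
    (hr : rank n y = rank n z) : ∀ i < n, y.1 i = z.1 i := by
  induction n with
  | zero => intro i hi; omega
  | succ n ih =>
    rw [vertex_succ, vertex_succ] at hv
    have he := edge_eq_of_add_offset_eq hv (rank_lt n y) (rank_lt n z) hr
    intro i hi
    rcases (Nat.lt_succ_iff.1 hi).eq_or_lt with rfl | h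
    · exact he
    · refine ih (by rw [vertex, vertex, he]) ?_ i h
      rw [rank, rank, he] at hr
      omega

theorem setOf_edge_eq_and_rank_eq {n : ℕ} (e : B.Edge n) {j : ℕ}
    (hj : j < B.towerHeight n e.source) :
    {y : B.PathSpace | y.1 n = e ∧ rank n y = j} = towerLevel (n + 1) e.tgt (j + e.offset) := by
  ext y
  constructor
  · rintro ⟨rfl, rfl⟩
    exact ⟨vertex_succ n y, rfl⟩
  · rintro ⟨h1, h2⟩
    rw [vertex_succ] at h1
    have he := edge_eq_of_add_offset_eq h1 (rank_lt n y) hj h2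
    refine ⟨he, ?_⟩
    rw [rank, he] at h2
    omega

theorem rank_eq_of_forall_eq {n : ℕ} {y z : B.PathSpace} (h : ∀ i < n, y.1 i = z.1 i) :
    rank n y = rank n z := by
  induction n with
  | zero => rfl
  | succ n ih => rw [rank, rank, ih fun i hi => h i (by omega), h n (by omega)]

theorem cylinder_eq_towerLevel (x : B.PathSpace) (n : ℕ) :
    cylinder x (n + 1) = towerLevel (n + 1) (vertex (n + 1) x) (rank (n + 1) x) := by
  ext y
  constructor
  · intro h
    refine ⟨?_, rank_eq_of_forall_eq h⟩
    rw [vertex_succ, vertex_succ, h n (by omega)]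
  · rintro ⟨h1, h2⟩
    exact eq_of_rank_eq h1 h2

theorem fillMin_of_le {k n : ℕ} (h : k ≤ n) (x : (n : ℕ) → B.Edge n) : fillMin k x n = x n := by
  induction k generalizing x with
  | zero => rfl
  | succ k ih =>
    rw [fillMin, ih (by omega), Function.update_of_ne (by omega)]

theorem fillMin_isMinimal {k n : ℕ} (h : n < k) (x : (n : ℕ) → B.Edge n) :
    (fillMin k x n).IsMinimal := by
  induction k generalizing x with
  | zero => omega
  | succ k ih =>
    rcases (Nat.lt_succ_iff.1 h).eq_or_lt with rfl | h
    · rw [fillMin, fillMin_of_le le_rfl, Function.update_self]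
      rfl
    · exact ih h _

/-- The action of the Vershik map on the edges of a path. -/
theorem vershik_cases (hmin : ∃ y : B.PathSpace, IsMinPath y) (y : B.PathSpace) :
    (∃ k, ∃ h : ¬ (y.1 k).IsMaximal, (∀ i < k, (y.1 i).IsMaximal ∧ ((vershik y).1 i).IsMinimal) ∧
      (vershik y).1 k = (y.1 k).succ h ∧ ∀ i, k < i → (vershik y).1 i = y.1 i) ∨
    ∀ i, (y.1 i).IsMaximal ∧ ((vershik y).1 i).IsMinimal := by
  classical
  by_cases h : ∃ k, ¬ (y.1 k).IsMaximal
  · left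
    have hv : (vershik y).1 = fillMin (Nat.find h)
        (Function.update y.1 (Nat.find h) ((y.1 (Nat.find h)).succ (Nat.find_spec h))) :=
      congrArg Subtype.val (dif_pos h)
    refine ⟨Nat.find h, Nat.find_spec h, fun i hi => ⟨not_not.1 (Nat.find_min h hi), ?_⟩, ?_,
      fun i hi => ?_⟩
    · rw [hv]
      exact fillMin_isMinimal hi _
    · rw [hv, fillMin_of_le le_rfl, Function.update_self]
    · rw [hv, fillMin_of_le hi.le, Function.update_of_ne hi.ne']
  · right
    have hv : vershik y = hmin.choose := (dif_neg h).trans (dif_pos hmin)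
    intro i
    refine ⟨by_contra fun hi => h ⟨i, hi⟩, ?_⟩
    rw [hv]
    exact hmin.choose_spec i

/-- The Vershik map goes up by one level in the towers of level `n`, or from the top of a tower to the
bottom of a tower. -/
theorem vershik_step (hmin : ∃ y : B.PathSpace, IsMinPath y) (n : ℕ) (y : B.PathSpace) :
    (vertex n (vershik y) = vertex n y ∧ rank n (vershik y) = rank n y + 1) ∨
    ∀ i < n, (y.1 i).IsMaximal ∧ ((vershik y).1 i).IsMinimal := by
  rcases vershik_cases hmin y with ⟨k, hk, h1, h2, h3⟩ | h
  · by_cases hkn : k < n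
    · left
      refine ⟨by rw [vertex, vertex, h3 n hkn], ?_⟩
      -- Below `k` the rank falls from height minus one to `0`, while the offset of edge `k` grows
      -- by that height: the net gain is one.
      induction n, hkn using Nat.le_induction with
      | base =>
        rw [Nat.succ_eq_add_one, rank, rank, h2, Edge.offset_succ,
          rank_eq_zero_of_isMinimal fun i hi => (h1 i hi).2]
        have := rank_add_one_of_isMaximal fun i hi => (h1 i hi).1
        simp only [vertex] at this
        omega
      | succ m hm ih => rw [rank, rank, ih, h3 m hm]; omega
    · exact Or.inr fun i hi => h1 i (by omega)
  · exact Or.inr fun i _ => h i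

theorem vertex_rank_vershik (hmin : ∃ y : B.PathSpace, IsMinPath y) {n : ℕ} {y : B.PathSpace}
    (h : rank n y + 1 < B.towerHeight n (vertex n y)) :
    vertex n (vershik y) = vertex n y ∧ rank n (vershik y) = rank n y + 1 := by
  refine (vershik_step hmin n y).resolve_right fun h' => ?_
  have := rank_add_one_of_isMaximal fun i hi => (h' i hi).1
  omega

theorem isMaximal_of_rank_add_one (hmin : ∃ y : B.PathSpace, IsMinPath y) {n : ℕ} {y : B.PathSpace}
    (h : rank n y + 1 = B.towerHeight n (vertex n y)) :
    ∀ i < n, (y.1 i).IsMaximal ∧ ((vershik y).1 i).IsMinimal := by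
  refine (vershik_step hmin n y).resolve_left fun h' => ?_
  have := rank_lt n (vershik y)
  rw [h'.1] at this
  omega

/-- A positive rank excludes an arrival at the bottom of a tower. This gives an equality of sets
without invertibility of the Vershik map, so invariance makes all levels of a tower equally heavy.
-/
theorem preimage_vershik_towerLevel (hmin : ∃ y : B.PathSpace, IsMinPath y) {n : ℕ} {v : B.V n}
    {j : ℕ} (hj : j + 1 < B.towerHeight n v) :
    vershik ⁻¹' towerLevel n v (j + 1) = towerLevel n v j := by
  ext y
  constructor
  · rintro ⟨h1, h2⟩
    rcases vershik_step hmin n y with h | h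
    · exact ⟨h.1.symm.trans h1, by omega⟩
    · have := rank_eq_zero_of_isMinimal fun i hi => (h i hi).2
      omega
  · rintro ⟨rfl, rfl⟩
    exact vertex_rank_vershik hmin hj

theorem iterate_vershik_mem_towerLevel (hmin : ∃ y : B.PathSpace, IsMinPath y) {n : ℕ} {v : B.V n}
    {j k : ℕ} (hj : j + k < B.towerHeight n v) {y : B.PathSpace} (hy : y ∈ towerLevel n v j) :
    vershik^[k] y ∈ towerLevel n v (j + k) := by
  induction k with
  | zero => exact hy
  | succ k ih =>
    rw [Function.iterate_succ_apply']
    have := ih (by omega)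
    rw [← preimage_vershik_towerLevel hmin (by omega)] at this
    exact this

theorem preimage_iterate_vershik_towerLevel (hmin : ∃ y : B.PathSpace, IsMinPath y) {n : ℕ}
    {v : B.V n} {j k : ℕ} (hj : j + k < B.towerHeight n v) :
    vershik^[k] ⁻¹' towerLevel n v (j + k) = towerLevel n v j := by
  induction k with
  | zero => rfl
  | succ k ih =>
    rw [Function.iterate_succ', Set.preimage_comp, ← add_assoc,
      preimage_vershik_towerLevel hmin (by omega), ih (by omega)]

/-! ### Measurability and mass of tower levels -/

theorem continuous_edge (n : ℕ) : Continuous fun y : B.PathSpace => y.1 n :=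
  (continuous_apply n).comp continuous_subtype_val

instance (n : ℕ) : DiscreteTopology (B.Edge n) := ⟨rfl⟩

theorem continuous_rank (n : ℕ) : Continuous (rank n : B.PathSpace → ℕ) := by
  induction n with
  | zero => exact continuous_const
  | succ n ih =>
    exact ih.add ((continuous_of_discreteTopology (f := Edge.offset)).comp (continuous_edge n))

theorem measurableSet_towerLevel (n : ℕ) (v : B.V n) (j : ℕ) :
    MeasurableSet (towerLevel n v j) := by
  refine IsOpen.measurableSet (IsOpen.inter ?_ ((isOpen_discrete {j}).preimage (continuous_rank n)))
  exact (isOpen_discrete {e : B.Edge n | e.source = v}).preimage (continuous_edge n)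

theorem measure_towerLevel (hmin : ∃ y : B.PathSpace, IsMinPath y) {μ : Measure B.PathSpace}
    (hμ : MeasurePreserving vershik μ μ) {n : ℕ} {v : B.V n} {j : ℕ}
    (hj : j < B.towerHeight n v) : μ.real (towerLevel n v j) = μ.real (towerLevel n v 0) := by
  have h := preimage_iterate_vershik_towerLevel hmin (n := n) (v := v) (j := 0) (k := j) (by omega)
  rw [← h, zero_add]
  exact ((hμ.iterate j).measureReal_preimage
    (measurableSet_towerLevel n v j).nullMeasurableSet).symm

theorem measure_tower {μ : Measure B.PathSpace} [IsFiniteMeasure μ]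
    (hmin : ∃ y : B.PathSpace, IsMinPath y)
    (hμ : MeasurePreserving vershik μ μ) (n : ℕ) (v : B.V n) :
    μ.real {y | vertex n y = v} =
      B.towerHeight n v * μ.real (towerLevel n v 0) := by
  have h : {y | vertex n y = v} =
      ⋃ j ∈ Finset.range (B.towerHeight n v), towerLevel n v j := by
    ext y
    simp only [Set.mem_iUnion, Finset.mem_range, exists_prop, Set.mem_ofPred_eq]
    refine ⟨?_, fun ⟨j, _, hj⟩ => hj.1⟩
    rintro rfl
    exact ⟨_, rank_lt n y, rfl, rfl⟩
  rw [h, measureReal_biUnion_finset]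
  · rw [Finset.sum_congr rfl fun j hj => measure_towerLevel hmin hμ (Finset.mem_range.1 hj)]
    simp
  · intro i _ j _ hij
    exact Set.disjoint_left.2 fun y hi hj => hij (hi.2.symm.trans hj.2)
  · exact fun j _ => measurableSet_towerLevel n v j

end OrderedBratteliDiagram

open OrderedBratteliDiagram

/-! ### The two towers of the Sturmian diagram -/

section SturmianTowers

variable {d pos : ℕ → ℕ} {hpos : ∀ k, 1 ≤ k → pos k ≤ d k}

/-- The sum of the numerator and the denominator of `[0 : d 1, …, d k]`. -/
def cfSum (d : ℕ → ℕ) (k : ℕ) : ℕ := cfNum d k + cfDen d k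

theorem cfSum_add_two (d : ℕ → ℕ) (k : ℕ) :
    cfSum d (k + 2) = d (k + 2) * cfSum d (k + 1) + cfSum d k := by
  simp only [cfSum, cfNum, cfDen]
  ring

variable (d pos hpos) in
theorem sturmian_towerHeight_one_succ (k : ℕ) :
    (sturmianDiagram d pos hpos).towerHeight (k + 2) TwoVertices.one =
      d (k + 1) * (sturmianDiagram d pos hpos).towerHeight (k + 1) TwoVertices.one +
        (sturmianDiagram d pos hpos).towerHeight (k + 1) TwoVertices.two := by
  have key (f : TwoVertices → ℕ) (D p : ℕ) (hp : p ≤ D) :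
      ∑ i : Fin (D + 1), f (if (i : ℕ) = p then TwoVertices.two else TwoVertices.one) =
        D * f TwoVertices.one + f TwoVertices.two := by
    have h1 : ∀ i : Fin (D + 1), f (if (i : ℕ) = p then TwoVertices.two else TwoVertices.one) =
        if i = ⟨p, Nat.lt_succ_of_le hp⟩ then f TwoVertices.two else f TwoVertices.one := by
      intro i
      simp only [Fin.ext_iff]
      split_ifs <;> rfl
    rw [Finset.sum_congr rfl fun i _ => h1 i, Finset.sum_ite]
    simp [Finset.filter_eq', Finset.filter_ne', add_comm]
  exact key _ (d (k + 1)) (pos (k + 1)) (hpos _ (Nat.succ_pos k))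

variable (d pos hpos) in
theorem sturmian_towerHeight_two_succ (k : ℕ) :
    (sturmianDiagram d pos hpos).towerHeight (k + 2) TwoVertices.two =
      (sturmianDiagram d pos hpos).towerHeight (k + 1) TwoVertices.one :=
  Fin.sum_univ_one _

variable (d pos hpos) in
theorem sturmian_towerHeight_level_one (v : TwoVertices) :
    (sturmianDiagram d pos hpos).towerHeight 1 v = 1 :=
  Fin.sum_univ_one _

variable (d pos hpos) in
theorem sturmian_towerHeight_one (k : ℕ) :
    (sturmianDiagram d pos hpos).towerHeight (k + 1) TwoVertices.one = cfSum d k := by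
  induction k using Nat.twoStepInduction with
  | zero => exact sturmian_towerHeight_level_one d pos hpos _
  | one =>
    rw [sturmian_towerHeight_one_succ]
    have h (v : TwoVertices) : (sturmianDiagram d pos hpos).towerHeight (0 + 1) v = 1 :=
      sturmian_towerHeight_level_one d pos hpos v
    rw [h, h]
    simp only [cfSum, cfNum, cfDen]
    ring
  | more k h1 h2 =>
    rw [sturmian_towerHeight_one_succ, h2, sturmian_towerHeight_two_succ, h1, cfSum_add_two]

variable (d pos hpos) in
theorem sturmian_towerHeight_two (k : ℕ) :
    (sturmianDiagram d pos hpos).towerHeight (k + 2) TwoVertices.two = cfSum d k := by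
  rw [sturmian_towerHeight_two_succ, sturmian_towerHeight_one]

theorem sturmian_source_eq_two_iff {k : ℕ} (e : (sturmianDiagram d pos hpos).Edge (k + 1)) :
    e.source = TwoVertices.two ↔ e.tgt = TwoVertices.one ∧ (e.idx : ℕ) = pos (k + 1) := by
  rcases e with ⟨_ | _, i⟩
  · change (if (i : ℕ) = pos (k + 1) then TwoVertices.two else TwoVertices.one) = TwoVertices.two ↔
      TwoVertices.one = TwoVertices.one ∧ (i : ℕ) = pos (k + 1)
    split_ifs with h <;> simp [h]
  · change TwoVertices.one = TwoVertices.two ↔ TwoVertices.two = TwoVertices.one ∧ _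
    simp

theorem sturmian_deg_one (k : ℕ) :
    (sturmianDiagram d pos hpos).deg (k + 1) TwoVertices.one = d (k + 1) + 1 := rfl

theorem sturmian_vertex_eq_one_or_two {k : ℕ} (v : (sturmianDiagram d pos hpos).V (k + 1)) :
    v = TwoVertices.one ∨ v = TwoVertices.two := by
  rcases v with _ | _
  · exact Or.inl rfl
  · exact Or.inr rfl

/-- The towers over the vertex `2` are never passed twice in succession. -/
theorem mem_towerLevel_one_of_vershik_mem_two
    (hmin : ∃ y : (sturmianDiagram d pos hpos).PathSpace, IsMinPath y) {k : ℕ}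
    (hd : 1 ≤ d (k + 1)) {z : (sturmianDiagram d pos hpos).PathSpace}
    (hz : vershik z ∈ towerLevel (B := sturmianDiagram d pos hpos) (k + 1) TwoVertices.two 0) :
    vertex (k + 1) z = TwoVertices.one ∧
      rank (k + 1) z + 1 =
        (sturmianDiagram d pos hpos).towerHeight (k + 1) TwoVertices.one := by
  obtain ⟨hz1, hz2⟩ := hz
  have htop : ∀ i < k + 1, (z.1 i).IsMaximal ∧ ((vershik z).1 i).IsMinimal := by
    refine (vershik_step hmin (k + 1) z).resolve_left fun h => ?_
    omega
  have hr := rank_add_one_of_isMaximal fun i hi => (htop i hi).1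
  rcases sturmian_vertex_eq_one_or_two (vertex (k + 1) z) with h | h
  · exact ⟨h, by rw [hr, h]⟩
  · exfalso
    obtain ⟨a1, a2⟩ := (sturmian_source_eq_two_iff _).1 h
    obtain ⟨b1, b2⟩ := (sturmian_source_eq_two_iff _).1 hz1
    -- Both edges have index `pos (k + 1)`; maximality of the first would make it `d (k + 1)`,
    -- minimality of the second `0`.
    have hmm : ¬ ((z.1 (k + 1)).IsMaximal ∧ ((vershik z).1 (k + 1)).IsMinimal) := by
      rintro ⟨c1, c2⟩
      unfold Edge.IsMaximal at c1
      unfold Edge.IsMinimal at c2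
      have h3 := (congrArg ((sturmianDiagram d pos hpos).deg (k + 1)) a1).trans (sturmian_deg_one k)
      omega
    rcases vershik_cases hmin z with ⟨j, hj, e1, e2, e3⟩ | e
    · rcases lt_trichotomy j (k + 1) with hjk | rfl | hjk
      · exact hj (htop j hjk).1
      · rw [e2] at b2
        change ((z.1 (k + 1)).idx : ℕ) + 1 = _ at b2
        omega
      · exact hmm (e1 _ hjk)
    · exact hmm (e _)

/-- Only one edge leaves the vertex `2`, so every path through this base continues along it into the
tower over `1` one level further down the diagram. -/
theorem towerLevel_two_zero (k : ℕ) :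
    ∃ j < (sturmianDiagram d pos hpos).towerHeight (k + 2) TwoVertices.one,
      towerLevel (B := sturmianDiagram d pos hpos) (k + 1) TwoVertices.two 0 =
        towerLevel (B := sturmianDiagram d pos hpos) (k + 2) TwoVertices.one j := by
  let e : (sturmianDiagram d pos hpos).Edge (k + 1) :=
    ⟨TwoVertices.one, ⟨pos (k + 1), Nat.lt_succ_of_le (hpos _ (Nat.succ_pos k))⟩⟩
  have he : e.source = TwoVertices.two := (sturmian_source_eq_two_iff e).2 ⟨rfl, rfl⟩
  have hpos' := towerHeight_pos (k + 1) e.source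
  have hlt : e.offset < (sturmianDiagram d pos hpos).towerHeight (k + 2) e.tgt :=
    (Nat.lt_add_of_pos_right hpos').trans_le e.offset_add_le
  refine ⟨e.offset, hlt, ?_⟩
  rw [← zero_add e.offset]
  refine Eq.trans ?_ (setOf_edge_eq_and_rank_eq e hpos')
  ext y
  refine and_congr_left fun _ => ⟨fun h => ?_, fun h => ?_⟩
  · obtain ⟨h1, h2⟩ := (sturmian_source_eq_two_iff _).1 h
    generalize y.1 (k + 1) = f at *
    obtain ⟨v, i⟩ := f
    obtain rfl : v = TwoVertices.one := h1
    exact congrArg (Edge.mk _) (Fin.ext h2)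
  · rw [vertex, h, he]

variable {μ : Measure (sturmianDiagram d pos hpos).PathSpace}

theorem measure_towerLevel_two (hmin : ∃ y : (sturmianDiagram d pos hpos).PathSpace, IsMinPath y)
    (hμ : MeasurePreserving vershik μ μ) (k : ℕ) :
    μ.real (towerLevel (B := sturmianDiagram d pos hpos) (k + 1) TwoVertices.two 0) =
      μ.real (towerLevel (B := sturmianDiagram d pos hpos) (k + 2) TwoVertices.one 0) := by
  obtain ⟨j, hj, h⟩ := towerLevel_two_zero (d := d) (pos := pos) (hpos := hpos) k
  rw [h, measure_towerLevel hmin hμ hj]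

theorem sturmian_total_measure [IsProbabilityMeasure μ]
    (hmin : ∃ y : (sturmianDiagram d pos hpos).PathSpace, IsMinPath y)
    (hμ : MeasurePreserving vershik μ μ) (k : ℕ) :
    ((sturmianDiagram d pos hpos).towerHeight (k + 1) TwoVertices.one : ℝ) *
        μ.real (towerLevel (B := sturmianDiagram d pos hpos) (k + 1) TwoVertices.one 0) +
      ((sturmianDiagram d pos hpos).towerHeight (k + 1) TwoVertices.two : ℝ) *
        μ.real (towerLevel (B := sturmianDiagram d pos hpos) (k + 2) TwoVertices.one 0) = 1 := by
  have h1 := measure_tower hmin hμ (k + 1) TwoVertices.one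
  have h2 := measure_tower hmin hμ (k + 1) TwoVertices.two
  rw [← measure_towerLevel_two hmin hμ k, ← h1, ← h2, ← measureReal_union]
  · convert probReal_univ (μ := μ)
    ext y
    simpa using sturmian_vertex_eq_one_or_two (vertex (k + 1) y)
  · refine Set.disjoint_left.2 fun y h1 h2 => ?_
    have h : TwoVertices.one = TwoVertices.two := Eq.trans (Eq.symm h1) h2
    cases h
  · refine IsOpen.measurableSet ?_
    exact (isOpen_discrete {e : (sturmianDiagram d pos hpos).Edge (k + 1) |
      e.source = TwoVertices.two}).preimage (continuous_edge (k + 1))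

end SturmianTowers

/-! ### Entrance law of a set with two return times -/

section EntranceTime

variable {X : Type*} {T : X → X} {I : Set X}

theorem entranceTime_eq_iff {j : ℕ} (hj : 0 < j) (y : X) :
    entranceTime T I y = j ↔ T^[j] y ∈ I ∧ ∀ i, 0 < i → i < j → T^[i] y ∉ I := by
  constructor
  · rintro rfl
    exact ⟨(Nat.sInf_mem (Nat.nonempty_of_pos_sInf hj)).2,
      fun i hi hij h => Nat.notMem_of_lt_sInf hij ⟨hi, h⟩⟩
  · rintro ⟨h1, h2⟩
    refine le_antisymm (Nat.sInf_le ⟨hj, h1⟩) (le_csInf ⟨j, hj, h1⟩ fun i hi => ?_)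
    by_contra! h
    exact h2 i hi.1 h hi.2

theorem setOf_entranceTime_eq_one : {y | entranceTime T I y = 1} = T ⁻¹' I := by
  ext y
  refine (entranceTime_eq_iff Nat.one_pos y).trans ⟨fun h => h.1, fun h => ⟨h, ?_⟩⟩
  intro i h1 h2
  omega

/-- Points of `I` are removed because `T y ∈ I` would already give entrance time `1`. The rule needs
`0 < j`, since the value `0` marks the points that never enter. -/
theorem setOf_entranceTime_eq_succ {j : ℕ} (hj : 0 < j) :
    {y | entranceTime T I y = j + 1} = T ⁻¹' ({y | entranceTime T I y = j} \ I) := by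
  ext y
  refine (entranceTime_eq_iff (Nat.succ_pos j) y).trans ?_
  refine Iff.trans ?_ (and_congr_left' (entranceTime_eq_iff hj (T y))).symm
  rw [Function.iterate_succ_apply]
  constructor
  · rintro ⟨h1, h2⟩
    exact ⟨⟨h1, fun i hi hij => h2 (i + 1) (by omega) (by omega)⟩, h2 1 Nat.one_pos (by omega)⟩
  · rintro ⟨⟨h1, h2⟩, h3⟩
    refine ⟨h1, fun i hi hij => ?_⟩
    obtain ⟨i, rfl⟩ : ∃ k, i = k + 1 := ⟨i - 1, by omega⟩
    rw [Function.iterate_succ_apply]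
    rcases i.eq_zero_or_pos with rfl | h
    · exact h3
    · exact h2 i h (by omega)

variable [MeasurableSpace X] {μ : Measure X}

theorem measurableSet_entranceTime_eq (hT : Measurable T) (hI : MeasurableSet I) {j : ℕ}
    (hj : 0 < j) : MeasurableSet {y | entranceTime T I y = j} := by
  induction j, hj using Nat.le_induction with
  | base => exact setOf_entranceTime_eq_one (T := T) (I := I) ▸ hT hI
  | succ j hj ih =>
    rw [setOf_entranceTime_eq_succ hj]
    exact hT (ih.diff hI)

theorem measure_entranceTime_eq_succ [IsFiniteMeasure μ] (hT : MeasurePreserving T μ μ)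
    (hI : MeasurableSet I) {j : ℕ} (hj : 0 < j) :
    μ.real {y | entranceTime T I y = j + 1} =
      μ.real {y | entranceTime T I y = j} - μ.real ({y | entranceTime T I y = j} ∩ I) := by
  have hm := measurableSet_entranceTime_eq hT.measurable hI hj
  rw [setOf_entranceTime_eq_succ hj, hT.measureReal_preimage (hm.diff hI).nullMeasurableSet,
    ← measureReal_sdiff_add_inter hI (s := {y | entranceTime T I y = j})]
  ring

variable {D : Set X} {p q : ℕ}

/-- No return takes less than `p` steps, so no mass is removed before time `p`. -/
theorem measure_entranceTime_eq_of_le [IsFiniteMeasure μ] (hT : MeasurePreserving T μ μ)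
    (hI : MeasurableSet I) (hshort : ∀ y ∈ I \ D, entranceTime T I y = p)
    (hlong : ∀ y ∈ D, entranceTime T I y = p + q) {j : ℕ} (hj : 0 < j) (hjp : j ≤ p) :
    μ.real {y | entranceTime T I y = j} = μ.real I := by
  induction j, hj using Nat.le_induction with
  | base =>
    rw [Nat.succ_eq_add_one, zero_add, setOf_entranceTime_eq_one,
      hT.measureReal_preimage hI.nullMeasurableSet]
  | succ j hj ih =>
    rw [measure_entranceTime_eq_succ hT hI hj, ih (by omega)]
    have : {y | entranceTime T I y = j} ∩ I = ∅ := by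
      refine Set.eq_empty_of_forall_notMem fun y ⟨h1, h2⟩ => ?_
      have h1 : entranceTime T I y = j := h1
      by_cases hy : y ∈ D
      · have := hlong y hy; omega
      · have := hshort y ⟨h2, hy⟩; omega
    rw [this, measureReal_empty, sub_zero]

/-- At time `p` exactly `I \ D` is removed, and then nothing more until time `p + q`. -/
theorem measure_entranceTime_eq_add [IsFiniteMeasure μ] (hT : MeasurePreserving T μ μ)
    (hI : MeasurableSet I) (hD : MeasurableSet D) (hDI : D ⊆ I) (hp : 0 < p)
    (hshort : ∀ y ∈ I \ D, entranceTime T I y = p)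
    (hlong : ∀ y ∈ D, entranceTime T I y = p + q) {j : ℕ} (hj : 0 < j) (hjq : j ≤ q) :
    μ.real {y | entranceTime T I y = p + j} = μ.real D := by
  induction j, hj using Nat.le_induction with
  | base =>
    rw [Nat.succ_eq_add_one, zero_add, measure_entranceTime_eq_succ hT hI hp,
      measure_entranceTime_eq_of_le hT hI hshort hlong hp le_rfl]
    have : {y | entranceTime T I y = p} ∩ I = I \ D := by
      ext y
      refine ⟨fun ⟨h1, h2⟩ => ⟨h2, fun h3 => ?_⟩, fun h => ⟨hshort y h, h.1⟩⟩
      have h1 : entranceTime T I y = p := h1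
      have := hlong y h3
      omega
    rw [this, measureReal_sdiff hDI hD]
    ring
  | succ j hj ih =>
    rw [← add_assoc, measure_entranceTime_eq_succ hT hI (by omega), ih (by omega)]
    have : {y | entranceTime T I y = p + j} ∩ I = ∅ := by
      refine Set.eq_empty_of_forall_notMem fun y ⟨h1, h2⟩ => ?_
      have h1 : entranceTime T I y = p + j := h1
      by_cases hy : y ∈ D
      · have := hlong y hy; omega
      · have := hshort y ⟨h2, hy⟩; omega
    rw [this, measureReal_empty, sub_zero]

theorem measure_entranceTime_mem_Icc [IsFiniteMeasure μ] (hT : MeasurePreserving T μ μ)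
    (hI : MeasurableSet I) (hD : MeasurableSet D) (hDI : D ⊆ I) (hp : 0 < p)
    (hshort : ∀ y ∈ I \ D, entranceTime T I y = p)
    (hlong : ∀ y ∈ D, entranceTime T I y = p + q) {m : ℕ} (hm : m ≤ p + q) :
    μ.real {y | 0 < entranceTime T I y ∧ entranceTime T I y ≤ m} =
      min (m : ℝ) p * μ.real I + max ((m : ℝ) - p) 0 * μ.real D := by
  induction m with
  | zero =>
    have : {y | 0 < entranceTime T I y ∧ entranceTime T I y ≤ 0} = ∅ :=
      Set.eq_empty_of_forall_notMem fun y ⟨h1, h2⟩ => by omega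
    rw [this]
    simp
  | succ m ih =>
    have hu : {y | 0 < entranceTime T I y ∧ entranceTime T I y ≤ m + 1} =
        {y | 0 < entranceTime T I y ∧ entranceTime T I y ≤ m} ∪
          {y | entranceTime T I y = m + 1} := by
      ext y
      change 0 < _ ∧ _ ↔ (0 < _ ∧ _) ∨ _ = _
      omega
    have hdisj : Disjoint {y | 0 < entranceTime T I y ∧ entranceTime T I y ≤ m}
        {y | entranceTime T I y = m + 1} := by
      refine Set.disjoint_left.2 fun y h1 h2 => ?_
      have h1 : 0 < entranceTime T I y ∧ entranceTime T I y ≤ m := h1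
      have h2 : entranceTime T I y = m + 1 := h2
      omega
    rw [hu, measureReal_union hdisj
      (measurableSet_entranceTime_eq hT.measurable hI (Nat.succ_pos m)), ih (by omega)]
    push_cast
    rcases lt_or_ge m p with h | h
    · rw [measure_entranceTime_eq_of_le hT hI hshort hlong (Nat.succ_pos m) h]
      have : (m : ℝ) + 1 ≤ p := by exact_mod_cast h
      rw [min_eq_left (by linarith), min_eq_left this, max_eq_right (by linarith),
        max_eq_right (by linarith)]
      ring
    · obtain ⟨k, rfl⟩ := Nat.exists_eq_add_of_le h
      rw [add_assoc p k 1, measure_entranceTime_eq_add hT hI hD hDI hp hshort hlong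
        (Nat.succ_pos k) (by omega)]
      have hk : (0 : ℝ) ≤ k := k.cast_nonneg
      push_cast
      rw [min_eq_right (by linarith), min_eq_right (by linarith), max_eq_left (by linarith),
        max_eq_left (by linarith)]
      ring

/-- The entrance law of a set `I` whose return time is `p` outside of `D ⊆ I` and `p + q` on `D`. -/
theorem entranceLaw_eq_min [IsProbabilityMeasure μ] (hT : MeasurePreserving T μ μ)
    (hI : MeasurableSet I) (hD : MeasurableSet D) (hDI : D ⊆ I) (hp : 0 < p)
    (hshort : ∀ y ∈ I \ D, entranceTime T I y = p)
    (hlong : ∀ y ∈ D, entranceTime T I y = p + q) (hI0 : 0 < μ.real I)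
    (htot : p * μ.real I + q * μ.real D = 1) {t : ℝ} (ht : 0 ≤ t) :
    entranceLaw μ T I t =
      min (min (⌊t / μ.real I⌋₊ * μ.real I)
        (p * μ.real I + (⌊t / μ.real I⌋₊ - p) * μ.real D)) 1 := by
  have hDle : μ.real D ≤ μ.real I := measureReal_mono hDI
  have hD0 : 0 ≤ μ.real D := measureReal_nonneg
  set m := ⌊t / μ.real I⌋₊ with hm
  have hset : {y | μ.real I * (entranceTime T I y : ℝ) ≤ t} = {y | entranceTime T I y ≤ m} := by
    ext y
    change _ ≤ t ↔ _ ≤ m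
    rw [hm, Nat.le_floor_iff (div_nonneg ht hI0.le), le_div_iff₀ hI0, mul_comm]
  have hcast : ((p + q : ℕ) : ℝ) = p + q := Nat.cast_add p q
  have hfull : μ.real {y | 0 < entranceTime T I y ∧ entranceTime T I y ≤ p + q} = 1 := by
    rw [measure_entranceTime_mem_Icc hT hI hD hDI hp hshort hlong le_rfl, hcast,
      min_eq_right (by linarith [(Nat.cast_nonneg q : (0 : ℝ) ≤ q)]),
      max_eq_left (by linarith [(Nat.cast_nonneg q : (0 : ℝ) ≤ q)])]
    linarith
  -- The value `0` is `sInf ∅`. These points are null because the times from `1` to `p + q` already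
  -- carry mass `1`.
  have hzero : μ.real {y | entranceTime T I y = 0} = 0 := by
    have hK : MeasurableSet {y | 0 < entranceTime T I y ∧ entranceTime T I y ≤ p + q} := by
      have : {y | 0 < entranceTime T I y ∧ entranceTime T I y ≤ p + q} =
          ⋃ j ∈ Set.Icc 1 (p + q), {y | entranceTime T I y = j} := by
        ext y
        simp [Nat.one_le_iff_ne_zero, Nat.pos_iff_ne_zero]
      rw [this]
      exact (Set.finite_Icc 1 (p + q)).measurableSet_biUnion fun j hj =>
        measurableSet_entranceTime_eq hT.measurable hI hj.1
    have hc := probReal_compl_eq_one_sub hK (μ := μ)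
    rw [hfull, sub_self] at hc
    refine le_antisymm (hc ▸ measureReal_mono fun y hy hy' => ?_) measureReal_nonneg
    exact hy'.1.ne' hy
  rw [entranceLaw, hset]
  rcases le_total m (p + q) with h | h
  · have h1 : μ.real {y | entranceTime T I y ≤ m} =
        μ.real {y | 0 < entranceTime T I y ∧ entranceTime T I y ≤ m} := by
      refine le_antisymm ?_ (measureReal_mono fun y hy => hy.2)
      rw [← add_zero (μ.real {y | 0 < entranceTime T I y ∧ entranceTime T I y ≤ m}), ← hzero]
      refine (measureReal_mono fun y hy => ?_).trans (measureReal_union_le _ _)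
      have hy : entranceTime T I y ≤ m := hy
      rcases (entranceTime T I y).eq_zero_or_pos with h0 | h0
      · exact Or.inr h0
      · exact Or.inl ⟨h0, hy⟩
    rw [h1, measure_entranceTime_mem_Icc hT hI hD hDI hp hshort hlong h]
    have hle : (m : ℝ) ≤ p + q := by exact_mod_cast h
    rcases le_total (m : ℝ) p with h2 | h2
    · have h3 : (m : ℝ) * μ.real I ≤ p * μ.real I + (m - p) * μ.real D := by nlinarith
      have h4 : (m : ℝ) * μ.real I ≤ 1 := by nlinarith [(Nat.cast_nonneg q : (0 : ℝ) ≤ q)]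
      rw [min_eq_left h2, max_eq_right (by linarith), min_eq_left h3, min_eq_left h4]
      ring
    · have h3 : p * μ.real I + (m - p) * μ.real D ≤ m * μ.real I := by nlinarith
      have h4 : p * μ.real I + (m - p) * μ.real D ≤ 1 := by nlinarith
      rw [min_eq_right h2, max_eq_left (by linarith), min_eq_right h3, min_eq_left h4]
  · have h1 : μ.real {y | entranceTime T I y ≤ m} = 1 := by
      refine le_antisymm measureReal_le_one ?_
      rw [← hfull]
      exact measureReal_mono fun y hy => hy.2.trans h
    have hle : (p : ℝ) + q ≤ m := by exact_mod_cast h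
    have hq : (0 : ℝ) ≤ q := q.cast_nonneg
    rw [h1, min_eq_right]
    refine le_min ?_ ?_ <;> nlinarith

theorem entranceLaw_of_neg (hI0 : 0 < μ.real I) {t : ℝ} (ht : t < 0) :
    entranceLaw μ T I t = 0 := by
  have : {y | μ.real I * (entranceTime T I y : ℝ) ≤ t} = ∅ :=
    Set.eq_empty_of_forall_notMem fun y hy => by
      have hy : μ.real I * (entranceTime T I y : ℝ) ≤ t := hy
      have := mul_nonneg hI0.le (Nat.cast_nonneg (α := ℝ) (entranceTime T I y))
      linarith
  rw [entranceLaw, this, measureReal_empty]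

end EntranceTime

/-! ### Return times to a tower level -/

namespace OrderedBratteliDiagram

variable {B : OrderedBratteliDiagram}

theorem rank_iterate_eq_zero (hmin : ∃ y : B.PathSpace, IsMinPath y) {n : ℕ} {v : B.V n} {j l : ℕ}
    (hl : 0 < l) (hjl : j + l = B.towerHeight n v) {y : B.PathSpace} (hy : y ∈ towerLevel n v j) :
    rank n (vershik^[l] y) = 0 := by
  obtain ⟨l, rfl⟩ : ∃ k, l = k + 1 := ⟨l - 1, by omega⟩
  obtain ⟨h1, h2⟩ := iterate_vershik_mem_towerLevel hmin (k := l) (by omega) hy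
  rw [Function.iterate_succ_apply']
  refine rank_eq_zero_of_isMinimal fun i hi => (isMaximal_of_rank_add_one hmin ?_ i hi).2
  rw [h1, h2]
  omega

section TwoTowers

variable {n : ℕ} {v w : B.V n} {j : ℕ}

/-- After the bottom is reached at time `m`, the rank counts the elapsed steps, so level `j` is met
after exactly `j` more. -/
theorem entranceTime_eq_of_iterate_mem (hmin : ∃ y : B.PathSpace, IsMinPath y)
    (hj : j < B.towerHeight n v) {y : B.PathSpace} {m : ℕ} (hm : 0 < m)
    (hbefore : ∀ i, 0 < i → i < m → vershik^[i] y ∉ towerLevel n v j)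
    (hbottom : vershik^[m] y ∈ towerLevel n v 0) :
    entranceTime vershik (towerLevel n v j) y = m + j := by
  refine (entranceTime_eq_iff (by omega) y).2 ⟨?_, fun i hi him => ?_⟩
  · have := iterate_vershik_mem_towerLevel hmin (k := j) (by omega) hbottom
    rwa [← Function.iterate_add_apply, zero_add, add_comm] at this
  · rcases lt_or_ge i m with h | h
    · exact hbefore i hi h
    · obtain ⟨k, rfl⟩ := Nat.exists_eq_add_of_le h
      have := iterate_vershik_mem_towerLevel hmin (k := k) (by omega) hbottom
      rw [← Function.iterate_add_apply, add_comm k m] at this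
      intro h'
      have h1 := this.2
      have h2 := h'.2
      omega

theorem iterate_vershik_notMem (hmin : ∃ y : B.PathSpace, IsMinPath y) {y : B.PathSpace}
    (hy : y ∈ towerLevel n v j) {i : ℕ} (hi : 0 < i) (hij : j + i < B.towerHeight n v) :
    vershik^[i] y ∉ towerLevel n v j := by
  intro h
  have h1 := (iterate_vershik_mem_towerLevel hmin hij hy).2
  have h2 := h.2
  omega

theorem entranceTime_of_bottom_mem (hmin : ∃ y : B.PathSpace, IsMinPath y)
    (hj : j < B.towerHeight n v) {y : B.PathSpace} (hy : y ∈ towerLevel n v j)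
    (hv : vertex n (vershik^[B.towerHeight n v - j] y) = v) :
    entranceTime vershik (towerLevel n v j) y = B.towerHeight n v := by
  rw [entranceTime_eq_of_iterate_mem hmin hj (m := B.towerHeight n v - j) (by omega)
    (fun i hi him => iterate_vershik_notMem hmin hy hi (by omega))
    ⟨hv, rank_iterate_eq_zero hmin (by omega) (by omega) hy⟩]
  omega

theorem entranceTime_of_bottom_mem_other (hmin : ∃ y : B.PathSpace, IsMinPath y)
    (hvw : v ≠ w) (huniv : ∀ u : B.V n, u = v ∨ u = w)
    (hww : ∀ z, vershik z ∈ towerLevel n w 0 → vertex n z = v)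
    (hj : j < B.towerHeight n v) {y : B.PathSpace} (hy : y ∈ towerLevel n v j)
    (hw : vershik^[B.towerHeight n v - j] y ∈ towerLevel n w 0) :
    entranceTime vershik (towerLevel n v j) y = B.towerHeight n v + B.towerHeight n w := by
  have hw0 := towerHeight_pos n w
  have hafter (k : ℕ) (hk : k < B.towerHeight n w) :
      vershik^[B.towerHeight n v - j + k] y ∈ towerLevel n w k := by
    have := iterate_vershik_mem_towerLevel hmin (k := k) (by omega) hw
    rwa [← Function.iterate_add_apply, zero_add, add_comm] at this
  have hr : rank n (vershik^[B.towerHeight n v - j + B.towerHeight n w] y) = 0 := by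
    rw [add_comm, Function.iterate_add_apply]
    exact rank_iterate_eq_zero hmin hw0 (zero_add _) hw
  rw [entranceTime_eq_of_iterate_mem hmin hj
    (m := B.towerHeight n v - j + B.towerHeight n w) (by omega) ?_ ⟨?_, hr⟩]
  · omega
  · intro i hi him
    rcases lt_or_ge i (B.towerHeight n v - j) with h | h
    · exact iterate_vershik_notMem hmin hy hi (by omega)
    · obtain ⟨k, rfl⟩ := Nat.exists_eq_add_of_le h
      exact fun h' => hvw (h'.1.symm.trans (hafter k (by omega)).1)
  · refine (huniv _).resolve_right fun h => ?_
    -- If the next bottom were again over `w`, the point just before it, still in the tower over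
    -- `w`, would have to lie over `v`.
    have hlast := (hafter (B.towerHeight n w - 1) (by omega)).1
    refine hvw ((hww (vershik^[B.towerHeight n v - j + (B.towerHeight n w - 1)] y) ?_).symm.trans
      hlast)
    rw [← Function.iterate_succ_apply' vershik]
    have he : (B.towerHeight n v - j + (B.towerHeight n w - 1)).succ =
      B.towerHeight n v - j + B.towerHeight n w := by omega
    rw [he]
    exact ⟨h, hr⟩

/-- A point just before the bottom over `w` is at the top over `v`, and going back from there leads
to level `j`. So the set `D` of long returns is a full preimage, with the mass of the base over `w`.
-/
theorem preimage_bottom_subset (hmin : ∃ y : B.PathSpace, IsMinPath y)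
    (hww : ∀ z, vershik z ∈ towerLevel n w 0 → vertex n z = v ∧ rank n z + 1 = B.towerHeight n v)
    (hj : j < B.towerHeight n v) :
    vershik^[B.towerHeight n v - j] ⁻¹' towerLevel n w 0 ⊆ towerLevel n v j := by
  intro y hy
  obtain ⟨k, hk⟩ : ∃ k, B.towerHeight n v - j = k + 1 := ⟨B.towerHeight n v - j - 1, by omega⟩
  rw [hk, Set.mem_preimage, Function.iterate_succ_apply'] at hy
  obtain ⟨h1, h2⟩ := hww _ hy
  rw [← preimage_iterate_vershik_towerLevel hmin (k := k) (by omega)]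
  exact ⟨h1, by omega⟩

/-- The entrance law of a level of the tower over `v`, if all paths are in the towers over `v` and `w`
and the tower over `w` is never passed twice in succession. -/
theorem entranceLaw_towerLevel (hmin : ∃ y : B.PathSpace, IsMinPath y)
    {μ : Measure B.PathSpace} [IsProbabilityMeasure μ] (hμ : MeasurePreserving vershik μ μ)
    (hvw : v ≠ w) (huniv : ∀ u : B.V n, u = v ∨ u = w)
    (hww : ∀ z, vershik z ∈ towerLevel n w 0 → vertex n z = v ∧ rank n z + 1 = B.towerHeight n v)
    (hj : j < B.towerHeight n v) {a b : ℝ} (ha : μ.real (towerLevel n v j) = a)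
    (hb : μ.real (towerLevel n w 0) = b) (ha0 : 0 < a)
    (htot : B.towerHeight n v * a + B.towerHeight n w * b = 1) {t : ℝ} (ht : 0 ≤ t) :
    entranceLaw μ vershik (towerLevel n v j) t =
      min (min (⌊t / a⌋₊ * a)
        (B.towerHeight n v * a + (⌊t / a⌋₊ - B.towerHeight n v) * b)) 1 := by
  have hm := measurableSet_towerLevel (B := B) n w 0
  have hD := (hμ.iterate (B.towerHeight n v - j)).measureReal_preimage hm.nullMeasurableSet
  subst ha hb
  rw [← hD] at htot ⊢
  refine entranceLaw_eq_min hμ (measurableSet_towerLevel n v j)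
    ((hμ.iterate _).measurable hm) (preimage_bottom_subset hmin hww hj) (towerHeight_pos n v)
    (fun y hy => ?_) (fun y hy => ?_) ha0 htot ht
  · refine entranceTime_of_bottom_mem hmin hj hy.1 ((huniv _).resolve_right fun h => hy.2 ?_)
    exact ⟨h, rank_iterate_eq_zero hmin (by omega) (by omega) hy.1⟩
  · exact entranceTime_of_bottom_mem_other hmin hvw huniv (fun z hz => (hww z hz).1) hj
      (preimage_bottom_subset hmin hww hj hy) hy

end TwoTowers

end OrderedBratteliDiagram

/-! ### Masses of cylinders and the entrance law in the Sturmian case -/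

section SturmianLaw

variable {d pos : ℕ → ℕ} {hpos : ∀ k, 1 ≤ k → pos k ≤ d k}
  {μ : Measure (sturmianDiagram d pos hpos).PathSpace}

/-- The measure of the cylinders that end at the vertex `1` of level `k + 1`. -/
noncomputable def sturmianMass (μ : Measure (sturmianDiagram d pos hpos).PathSpace) (k : ℕ) : ℝ :=
  μ.real (towerLevel (B := sturmianDiagram d pos hpos) (k + 1) TwoVertices.one 0)

theorem sturmianMass_total [IsProbabilityMeasure μ]
    (hmin : ∃ y : (sturmianDiagram d pos hpos).PathSpace, IsMinPath y)
    (hμ : MeasurePreserving vershik μ μ) (k : ℕ) :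
    (cfSum d (k + 1) : ℝ) * sturmianMass μ (k + 1) +
      (cfSum d k : ℝ) * sturmianMass μ (k + 2) = 1 := by
  have h := sturmian_total_measure hmin hμ (k + 1)
  rw [sturmian_towerHeight_one d pos hpos (k + 1), sturmian_towerHeight_two d pos hpos k] at h
  exact h

theorem sturmianMass_total_zero [IsProbabilityMeasure μ]
    (hmin : ∃ y : (sturmianDiagram d pos hpos).PathSpace, IsMinPath y)
    (hμ : MeasurePreserving vershik μ μ) :
    sturmianMass μ 0 + sturmianMass μ 1 = 1 := by
  have h := sturmian_total_measure hmin hμ 0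
  have h1 (v : TwoVertices) : (sturmianDiagram d pos hpos).towerHeight (0 + 1) v = 1 :=
    sturmian_towerHeight_level_one d pos hpos v
  rw [h1, h1, Nat.cast_one, one_mul, one_mul] at h
  exact h

theorem cylinder_eq_of_terminal {x : (sturmianDiagram d pos hpos).PathSpace} {k : ℕ}
    (hx : sturmianTerminal x (k + 1) = TwoVertices.one) :
    ∃ j < (sturmianDiagram d pos hpos).towerHeight (k + 1) TwoVertices.one,
      cylinder x (k + 1) =
        towerLevel (B := sturmianDiagram d pos hpos) (k + 1) TwoVertices.one j := by
  have hv : vertex (k + 1) x = TwoVertices.one := (vertex_succ k x).trans hx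
  refine ⟨rank (k + 1) x, ?_, ?_⟩
  · rw [← hv]
    exact rank_lt _ _
  · rw [cylinder_eq_towerLevel, hv]

theorem measure_cylinder_of_terminal
    (hmin : ∃ y : (sturmianDiagram d pos hpos).PathSpace, IsMinPath y)
    (hμ : MeasurePreserving vershik μ μ) {x : (sturmianDiagram d pos hpos).PathSpace} {k : ℕ}
    (hx : sturmianTerminal x (k + 1) = TwoVertices.one) :
    μ.real (cylinder x (k + 1)) = sturmianMass μ k := by
  obtain ⟨j, hj, h⟩ := cylinder_eq_of_terminal hx
  rw [h, measure_towerLevel hmin hμ hj]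
  rfl

theorem entranceLaw_cylinder [IsProbabilityMeasure μ]
    (hmin : ∃ y : (sturmianDiagram d pos hpos).PathSpace, IsMinPath y)
    (hμ : MeasurePreserving vershik μ μ) {x : (sturmianDiagram d pos hpos).PathSpace} {k : ℕ}
    (hd : 1 ≤ d (k + 2)) (hx : sturmianTerminal x (k + 2) = TwoVertices.one)
    (ha0 : 0 < sturmianMass μ (k + 1)) {t : ℝ} (ht : 0 ≤ t) :
    entranceLaw μ vershik (cylinder x (k + 2)) t =
      min (min (⌊t / sturmianMass μ (k + 1)⌋₊ * sturmianMass μ (k + 1))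
        (cfSum d (k + 1) * sturmianMass μ (k + 1) +
          (⌊t / sturmianMass μ (k + 1)⌋₊ - cfSum d (k + 1)) * sturmianMass μ (k + 2))) 1 := by
  have hI := measure_cylinder_of_terminal hmin hμ hx
  obtain ⟨j, hj, h⟩ := cylinder_eq_of_terminal hx
  have hH1 := sturmian_towerHeight_one d pos hpos (k + 1)
  have hH2 := sturmian_towerHeight_two d pos hpos k
  rw [h] at hI ⊢
  have htot := sturmianMass_total hmin hμ k
  rw [← hH1, ← hH2] at htot
  rw [← hH1]
  refine entranceLaw_towerLevel hmin hμ ?_ (sturmian_vertex_eq_one_or_two (k := k + 1))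
    (fun z hz => mem_towerLevel_one_of_vershik_mem_two hmin hd hz) hj hI
    (measure_towerLevel_two hmin hμ (k + 1)) ha0 htot ht
  intro h
  have h : TwoVertices.one = TwoVertices.two := h
  cases h

end SturmianLaw

/-! ### Masses and the continued fraction of `β` -/

section ContinuedFraction

variable {d : ℕ → ℕ}

theorem one_le_cfDen (hd : ∀ k, 1 ≤ k → 1 ≤ d k) (k : ℕ) : 1 ≤ cfDen d k := by
  induction k using Nat.twoStepInduction with
  | zero => exact le_rfl
  | one => exact hd 1 le_rfl
  | more k h1 h2 => exact h1.trans (Nat.le_add_left _ _)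

theorem add_one_le_cfSum (hd : ∀ k, 1 ≤ k → 1 ≤ d k) (k : ℕ) : k + 1 ≤ cfSum d k := by
  induction k using Nat.twoStepInduction with
  | zero => exact le_rfl
  | one =>
    have := hd 1 le_rfl
    simp only [cfSum, cfNum, cfDen]
    omega
  | more k h1 h2 =>
    rw [cfSum_add_two]
    have := Nat.mul_le_mul_right (cfSum d (k + 1)) (hd (k + 2) (by omega))
    omega

theorem cfSum_pos (hd : ∀ k, 1 ≤ k → 1 ≤ d k) (k : ℕ) : (0 : ℝ) < cfSum d k := by
  exact_mod_cast (Nat.succ_pos k).trans_le (add_one_le_cfSum hd k)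

variable {a : ℕ → ℝ}

/-- Subtract two consecutive total-mass identities, expand `cfSum d (k + 2)` and cancel `cfSum d (k
+ 1)`. The first step uses `h0` instead. -/
theorem mass_recurrence (hd : ∀ k, 1 ≤ k → 1 ≤ d k) (h0 : a 0 + a 1 = 1)
    (h : ∀ k, cfSum d (k + 1) * a (k + 1) + cfSum d k * a (k + 2) = 1) (k : ℕ) :
    a k = d (k + 1) * a (k + 1) + a (k + 2) := by
  cases k with
  | zero =>
    have h1 := h 0
    have h2 : (cfSum d 1 : ℝ) = 1 + d 1 := by simp [cfSum, cfNum, cfDen]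
    have h3 : (cfSum d 0 : ℝ) = 1 := by simp [cfSum, cfNum, cfDen]
    rw [zero_add, h2, h3] at h1
    rw [zero_add]
    linarith
  | succ k =>
    have h1 := h k
    have h2 := h (k + 1)
    have h3 : (cfSum d (k + 2) : ℝ) = d (k + 2) * cfSum d (k + 1) + cfSum d k := by
      exact_mod_cast cfSum_add_two d k
    refine mul_left_cancel₀ (cfSum_pos hd (k + 1)).ne' ?_
    rw [h3] at h2
    linear_combination h1 - h2

/-- The masses decrease, so a zero at a positive index would make the next mass zero too, against
total mass one. -/
theorem mass_pos (hd : ∀ k, 1 ≤ k → 1 ≤ d k) (ha : ∀ k, 0 ≤ a k)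
    (h : ∀ k, cfSum d (k + 1) * a (k + 1) + cfSum d k * a (k + 2) = 1)
    (hrec : ∀ k, a k = d (k + 1) * a (k + 1) + a (k + 2)) (k : ℕ) : 0 < a k := by
  have hle (k : ℕ) : a (k + 1) ≤ a k := by
    have h1 : (1 : ℝ) ≤ d (k + 1) := by exact_mod_cast hd (k + 1) (by omega)
    nlinarith [hrec k, ha (k + 1), ha (k + 2)]
  have hs (k : ℕ) : 0 < a (k + 1) := by
    refine (ha (k + 1)).lt_of_ne fun h1 => ?_
    have h2 : a (k + 2) = 0 := le_antisymm (h1 ▸ hle (k + 1)) (ha _)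
    have := h k
    rw [← h1, h2] at this
    simp at this
  exact (hs k).trans_le (hle k)

theorem mass_succ_lt (hd : ∀ k, 1 ≤ k → 1 ≤ d k) (ha : ∀ k, 0 < a k)
    (hrec : ∀ k, a k = d (k + 1) * a (k + 1) + a (k + 2)) (k : ℕ) : a (k + 1) < a k := by
  have h1 : (1 : ℝ) ≤ d (k + 1) := by exact_mod_cast hd (k + 1) (by omega)
  nlinarith [hrec k, ha (k + 1), ha (k + 2)]

theorem tendsto_mass (hd : ∀ k, 1 ≤ k → 1 ≤ d k) (ha : ∀ k, 0 < a k)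
    (h : ∀ k, cfSum d (k + 1) * a (k + 1) + cfSum d k * a (k + 2) = 1) :
    Tendsto a atTop (𝓝 0) := by
  rw [← tendsto_add_atTop_iff_nat 1]
  refine squeeze_zero (fun k => (ha _).le) (fun k => ?_) tendsto_one_div_add_atTop_nhds_zero_nat
  rw [le_div_iff₀ (by positivity)]
  have h1 : (k : ℝ) + 1 ≤ cfSum d (k + 1) := by
    have := add_one_le_cfSum hd (k + 1)
    exact_mod_cast (by omega : k + 1 ≤ cfSum d (k + 1))
  nlinarith [h k, ha (k + 1), mul_pos (cfSum_pos hd k) (ha (k + 2))]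

/-- Divided by `q_k * a 0`, this is the error of the `k`-th convergent of `a 1 / a 0`; it identifies
`β`. -/
theorem cfDen_mul_sub_cfNum_mul (hrec : ∀ k, a k = d (k + 1) * a (k + 1) + a (k + 2)) (k : ℕ) :
    cfDen d k * a 1 - cfNum d k * a 0 = (-1) ^ k * a (k + 1) := by
  induction k using Nat.twoStepInduction with
  | zero => simp [cfDen, cfNum]
  | one =>
    have := hrec 0
    simp only [cfDen, cfNum, zero_add] at *
    push_cast
    linarith
  | more k h1 h2 =>
    have h3 := hrec (k + 1)
    simp only [cfDen, cfNum]
    push_cast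
    linear_combination d (k + 2) * h2 + h1 + (-1) ^ k * h3

theorem tendsto_convergents (hd : ∀ k, 1 ≤ k → 1 ≤ d k) (ha : ∀ k, 0 < a k)
    (h : ∀ k, cfSum d (k + 1) * a (k + 1) + cfSum d k * a (k + 2) = 1)
    (hrec : ∀ k, a k = d (k + 1) * a (k + 1) + a (k + 2)) :
    Tendsto (fun k => (cfNum d k : ℝ) / cfDen d k) atTop (𝓝 (a 1 / a 0)) := by
  rw [tendsto_iff_dist_tendsto_zero]
  have hlim := (((tendsto_add_atTop_iff_nat 1).2 (tendsto_mass hd ha h)).div_const (a 0))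
  rw [zero_div] at hlim
  refine squeeze_zero (fun k => dist_nonneg) (fun k => ?_) hlim
  have hq : (1 : ℝ) ≤ cfDen d k := by exact_mod_cast one_le_cfDen hd k
  have he : a 1 / a 0 - cfNum d k / cfDen d k = (-1) ^ k * a (k + 1) / (a 0 * cfDen d k) := by
    rw [← cfDen_mul_sub_cfNum_mul hrec k]
    have := (ha 0).ne'
    have : (cfDen d k : ℝ) ≠ 0 := by positivity
    field_simp
  rw [dist_comm, Real.dist_eq, he, abs_div, abs_mul, abs_pow, abs_neg, abs_one, one_pow, one_mul,
    abs_of_pos (ha _), abs_of_pos (mul_pos (ha 0) (by positivity))]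
  refine div_le_div_of_nonneg_left (ha _).le (ha 0) ?_
  nlinarith [ha 0]

theorem one_div_mass_ratio (ha : ∀ k, 0 < a k)
    (hrec : ∀ k, a k = d (k + 1) * a (k + 1) + a (k + 2)) (k : ℕ) :
    1 / (a (k + 1) / a k) = d (k + 1) + a (k + 2) / a (k + 1) := by
  have := (ha (k + 1)).ne'
  rw [one_div_div, div_eq_iff this, add_mul, div_mul_cancel₀ _ this]
  exact hrec k

theorem gaussMap_mass_ratio (hd : ∀ k, 1 ≤ k → 1 ≤ d k) (ha : ∀ k, 0 < a k)
    (hrec : ∀ k, a k = d (k + 1) * a (k + 1) + a (k + 2)) (k : ℕ) :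
    gaussMap (a (k + 1) / a k) = a (k + 2) / a (k + 1) := by
  rw [gaussMap, one_div_mass_ratio ha hrec, Int.fract_natCast_add, Int.fract_eq_self]
  exact ⟨(div_pos (ha _) (ha _)).le, (div_lt_one (ha _)).2 (mass_succ_lt hd ha hrec _)⟩

theorem iterate_gaussMap_mass_ratio (hd : ∀ k, 1 ≤ k → 1 ≤ d k) (ha : ∀ k, 0 < a k)
    (hrec : ∀ k, a k = d (k + 1) * a (k + 1) + a (k + 2)) (k : ℕ) :
    gaussMap^[k] (a 1 / a 0) = a (k + 1) / a k := by
  induction k with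
  | zero => rfl
  | succ k ih => rw [Function.iterate_succ_apply', ih, gaussMap_mass_ratio hd ha hrec]

theorem tendsto_cfSum_div_cfDen (hd : ∀ k, 1 ≤ k → 1 ≤ d k) {β : ℝ}
    (hβ : Tendsto (fun k => (cfNum d k : ℝ) / cfDen d k) atTop (𝓝 β)) :
    Tendsto (fun k => (cfSum d k : ℝ) / cfDen d k) atTop (𝓝 (β + 1)) := by
  refine (hβ.add_const 1).congr fun k => ?_
  have hq : (1 : ℝ) ≤ cfDen d k := by exact_mod_cast one_le_cfDen hd k
  rw [cfSum]
  push_cast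
  field_simp

end ContinuedFraction

/-! ### Limits of the piecewise linear laws -/

section PiecewiseLinear

variable {h₁ h₂ ρ κ : ℝ}

/-- The law is concave on `[0, ∞[`, hence the minimum of its three lines. Here `ρ` is the middle
slope and `κ` the distance between the breaks. -/
theorem piecewiseLinearLaw_eq_min (hρ0 : 0 ≤ ρ) (hρ1 : ρ < 1) (hκ : 0 < κ)
    (hh₁ : h₁ = 1 - ρ * κ) (hh₂ : h₂ = h₁ + κ) (hpos : 0 < h₁) (t : ℝ) :
    piecewiseLinearLaw h₁ h₂ t = min (min (max t 0) (h₁ + (max t 0 - h₁) * ρ)) 1 := by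
  have h1 : h₁ ≤ 1 := by nlinarith
  rw [piecewiseLinearLaw]
  split_ifs with a b c
  · have h2 : 0 ≤ h₁ + (0 - h₁) * ρ := by nlinarith
    rw [max_eq_right a, min_eq_left h2, min_eq_left zero_le_one]
  · have h2 : t ≤ h₁ + (t - h₁) * ρ := by nlinarith
    rw [max_eq_left (by linarith), min_eq_left h2, min_eq_left (by linarith)]
  · have h2 : h₁ + (t - h₁) * ρ ≤ t := by nlinarith
    have h3 : h₁ + (t - h₁) * ρ ≤ 1 := by nlinarith
    rw [max_eq_left (by linarith), min_eq_right h2, min_eq_left h3]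
    have : (1 - h₁) * (t - h₁) / (h₂ - h₁) = (t - h₁) * ρ := by
      rw [hh₂, add_sub_cancel_left, div_eq_iff hκ.ne', hh₁]
      ring
    rw [this]
  · rw [max_eq_left (by linarith), min_eq_right]
    exact le_min (by nlinarith) (by nlinarith)

theorem continuous_piecewiseLinearLaw (hρ0 : 0 ≤ ρ) (hρ1 : ρ < 1) (hκ : 0 < κ)
    (hh₁ : h₁ = 1 - ρ * κ) (hh₂ : h₂ = h₁ + κ) (hpos : 0 < h₁) :
    Continuous (piecewiseLinearLaw h₁ h₂) := by
  rw [funext (piecewiseLinearLaw_eq_min hρ0 hρ1 hκ hh₁ hh₂ hpos)]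
  fun_prop

theorem fract_mul_one_sub_fract_le (x : ℝ) (m : ℤ) :
    Int.fract x * (1 - Int.fract x) ≤ |x - m| := by
  have h0 := Int.fract_nonneg x
  have h1 := Int.fract_lt_one x
  have h2 := Int.floor_add_fract x
  rcases le_or_gt m ⌊x⌋ with h | h
  · have : (m : ℝ) ≤ ⌊x⌋ := by exact_mod_cast h
    exact le_trans (by nlinarith) (le_abs_self _)
  · have : (⌊x⌋ : ℝ) + 1 ≤ m := by exact_mod_cast h
    exact le_trans (by nlinarith) (neg_le_abs _)

variable {ι : Type*} {L : Filter ι} {g B u : ι → ℝ} {γ t : ℝ}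

theorem tendsto_fract_of_ne_int (hg : Tendsto g L (𝓝 γ)) (hγ : ∀ m : ℤ, γ ≠ m) :
    Tendsto (fun i => Int.fract (g i)) L (𝓝 (Int.fract γ)) :=
  (continuousAt_fract (hγ ⌊γ⌋)).tendsto.comp hg

/-- The fractional part is right-continuous at integers, and the value `1` can only be approached
from the right since `1 ≤ g i`. -/
theorem tendsto_fract_of_ne_two_le (hg : Tendsto g L (𝓝 γ)) (hg1 : ∀ᶠ i in L, 1 ≤ g i)
    (hγ1 : 1 ≤ γ) (hγ : ∀ m : ℕ, 2 ≤ m → γ ≠ m) :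
    Tendsto (fun i => Int.fract (g i)) L (𝓝 (Int.fract γ)) := by
  by_cases h : ∃ m : ℤ, γ = m
  · obtain ⟨m, rfl⟩ := h
    have hm : 1 ≤ m := by exact_mod_cast hγ1
    obtain rfl : m = 1 := by
      by_contra hne
      refine hγ m.toNat (by omega) ?_
      exact_mod_cast (Int.toNat_of_nonneg (by omega)).symm
    rw [Int.fract_intCast]
    have hlim := hg.sub_const ((1 : ℤ) : ℝ)
    rw [sub_self] at hlim
    refine tendsto_of_tendsto_of_tendsto_of_le_of_le' tendsto_const_nhds hlim
      (Eventually.of_forall fun i => Int.fract_nonneg _) ?_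
    filter_upwards [hg1] with i hi
    have h1 : 1 ≤ ⌊g i⌋ := Int.le_floor.2 (by exact_mod_cast hi)
    have h2 : ((1 : ℤ) : ℝ) ≤ ⌊g i⌋ := by exact_mod_cast h1
    rw [Int.fract]
    linarith
  · push Not at h
    exact tendsto_fract_of_ne_int hg h

theorem tendsto_min_law (hg : Tendsto g L (𝓝 γ)) (hB : Tendsto B L (𝓝 κ))
    (hB0 : ∀ᶠ i in L, 0 ≤ B i) (hu : Tendsto u L (𝓝 t)) :
    Tendsto (fun i => min (min (u i) (1 - Int.fract (g i) * B i +
        (u i - (1 - Int.fract (g i) * B i)) * Int.fract (g i))) 1) L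
      (𝓝 (min (min t (1 - Int.fract γ * κ + (t - (1 - Int.fract γ * κ)) * Int.fract γ)) 1)) := by
  -- With `ρ = Int.fract (g i)`, the middle line equals `(1 - ρ) + ρ u - ρ (1 - ρ) B`, which is at
  -- least `min u 1 - |g i - m| B`. So no limit of `ρ` is needed in the integer case.
  by_cases h : ∃ m : ℤ, γ = m
  · obtain ⟨m, rfl⟩ := h
    simp only [Int.fract_intCast, zero_mul, sub_zero, mul_zero, add_zero, min_assoc, min_self]
    have hup : Tendsto (fun i => min (u i) 1) L (𝓝 (min t 1)) := hu.min tendsto_const_nhds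
    have herr : Tendsto (fun i => |g i - m| * B i) L (𝓝 0) := by
      have h1 := (hg.sub_const (m : ℝ)).abs.mul hB
      simpa using h1
    have hlow := hup.sub herr
    rw [sub_zero] at hlow
    refine tendsto_of_tendsto_of_tendsto_of_le_of_le' hlow hup ?_ ?_
    · filter_upwards [hB0] with i hi
      have h0 := Int.fract_nonneg (g i)
      have h1 := Int.fract_lt_one (g i)
      have h2 := mul_le_mul_of_nonneg_right (fract_mul_one_sub_fract_le (g i) m) hi
      have h3 := mul_nonneg (abs_nonneg (g i - m)) hi
      have h4 := min_le_left (u i) 1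
      have h5 := min_le_right (u i) 1
      refine le_min (by linarith) (le_min ?_ (by linarith))
      nlinarith
    · exact Eventually.of_forall fun i => le_min (min_le_left _ _)
        ((min_le_right _ _).trans (min_le_right _ _))
  · push Not at h
    have hf := tendsto_fract_of_ne_int hg h
    have hA := (hf.mul hB).const_sub 1
    exact (hu.min (hA.add ((hu.sub hA).mul hf))).min tendsto_const_nhds

theorem tendsto_floor_div_mul {a : ι → ℝ} (ha0 : ∀ᶠ i in L, 0 < a i) (ha : Tendsto a L (𝓝 0))
    (ht : 0 ≤ t) : Tendsto (fun i => ⌊t / a i⌋₊ * a i) L (𝓝 t) := by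
  have hlow := ha.const_sub t
  rw [sub_zero] at hlow
  refine tendsto_of_tendsto_of_tendsto_of_le_of_le' hlow tendsto_const_nhds ?_ ?_
  · filter_upwards [ha0] with i hi
    have := Nat.lt_floor_add_one (t / a i)
    rw [div_lt_iff₀ hi] at this
    linarith
  · filter_upwards [ha0] with i hi
    have := Nat.floor_le (div_nonneg ht hi.le)
    rwa [le_div_iff₀ hi] at this

end PiecewiseLinear

/-! ### Proof of the limit theorem -/

/-- `(p_k + q_k) / q_k` tends to `β + 1 ≠ 0`, so tower heights have the same limiting ratio as the
denominators. -/
theorem tendsto_cfSum_ratio {d : ℕ → ℕ} (hd : ∀ k, 1 ≤ k → 1 ≤ d k) {β w : ℝ} (hβ0 : 0 < β)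
    (hβ : Tendsto (fun k => (cfNum d k : ℝ) / cfDen d k) atTop (𝓝 β)) {L : Filter ℕ}
    {f g : ℕ → ℕ} (hf : Tendsto f L atTop) (hg : Tendsto g L atTop)
    (hw : Tendsto (fun n => (cfDen d (f n) : ℝ) / cfDen d (g n)) L (𝓝 w)) :
    Tendsto (fun n => (cfSum d (f n) : ℝ) / cfSum d (g n)) L (𝓝 w) := by
  have h := tendsto_cfSum_div_cfDen hd hβ
  have hlim := hw.mul ((h.comp hf).div (h.comp hg) (by positivity))
  rw [div_self (by positivity), mul_one] at hlim
  refine hlim.congr fun n => ?_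
  have h1 : (1 : ℝ) ≤ cfDen d (f n) := by exact_mod_cast one_le_cfDen hd _
  have h2 : (1 : ℝ) ≤ cfDen d (g n) := by exact_mod_cast one_le_cfDen hd _
  have h3 := cfSum_pos hd (g n)
  simp only [Pi.div_apply, Function.comp_apply]
  field_simp

theorem mainTheorem4
    (α : ℝ) (hα0 : 0 < α) (hα1 : α < 1) (hα : Irrational α)
    (d pos : ℕ → ℕ) (hd : ∀ k, 1 ≤ k → 1 ≤ d k) (hpos : ∀ k, 1 ≤ k → pos k ≤ d k)
    (hproper : (sturmianDiagram d pos hpos).IsProperlyOrdered)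
    (hrep : (sturmianDiagram d pos hpos).RepresentsSturmian α)
    (μ : Measure (sturmianDiagram d pos hpos).PathSpace) [IsProbabilityMeasure μ]
    (hμ : MeasurePreserving OrderedBratteliDiagram.vershik μ μ)
    (β : ℝ) (hβ : Tendsto (fun k => (cfNum d k : ℝ) / cfDen d k) atTop (𝓝 β))
    (x : (sturmianDiagram d pos hpos).PathSpace)
    (M : Set ℕ) (hM : M.Infinite) (hM1 : ∀ n ∈ M, 1 ≤ n ∧ sturmianTerminal x n = TwoVertices.one)
    (w θ : ℝ) (hθ : 0 < θ)
    (hw_lim : Tendsto (fun n => (cfDen d (n - 3) : ℝ) / cfDen d (n - 2)) (atTop ⊓ 𝓟 M) (𝓝 w))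
    (hθ_lim : Tendsto (fun n => gaussMap^[n - 2] β) (atTop ⊓ 𝓟 M) (𝓝 θ))
    (h₁ h₂ : ℝ) (hh₁ : h₁ = (⌊1 / θ⌋ + w) * θ / (1 + θ * w))
    (hh₂ : h₂ = (1 + ⌊1 / θ⌋ + w) * θ / (1 + θ * w)) :
    (0 < h₁ ∧ h₁ ≤ 1 ∧ 1 ≤ h₂ ∧ h₁ < h₂) ∧
    Continuous (piecewiseLinearLaw h₁ h₂) ∧
    (∀ t : ℝ, Tendsto
      (fun n => entranceLaw μ OrderedBratteliDiagram.vershik (OrderedBratteliDiagram.cylinder x n) t)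
      (atTop ⊓ 𝓟 M) (𝓝 (piecewiseLinearLaw h₁ h₂ t))) ∧
    ((∀ m : ℕ, 2 ≤ m → 1 / θ ≠ m) →
      Tendsto (fun n => ((cfNum d (n - 1) : ℝ) + cfDen d (n - 1)) *
          μ.real (OrderedBratteliDiagram.cylinder x n)) (atTop ⊓ 𝓟 M) (𝓝 h₁) ∧
      Tendsto (fun n => ((cfNum d (n - 1) : ℝ) + cfDen d (n - 1) + cfNum d (n - 2) + cfDen d (n - 2)) *
          μ.real (OrderedBratteliDiagram.cylinder x n)) (atTop ⊓ 𝓟 M) (𝓝 h₂)) := by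
  have hmin : ∃ y : (sturmianDiagram d pos hpos).PathSpace, IsMinPath y := hproper.2.exists
  set a := sturmianMass μ with ha_def
  have htot := sturmianMass_total hmin hμ
  have hrec := mass_recurrence hd (sturmianMass_total_zero hmin hμ) htot
  have ha : ∀ k, 0 < a k := mass_pos hd (fun k => measureReal_nonneg) htot hrec
  rw [← ha_def] at htot hrec
  obtain rfl : β = a 1 / a 0 := tendsto_nhds_unique hβ (tendsto_convergents hd ha htot hrec)
  set L : Filter ℕ := atTop ⊓ 𝓟 M with hL
  have : L.NeBot := by
    rw [hL, ← frequently_mem_iff_neBot]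
    exact Nat.frequently_atTop_iff_infinite.2 hM
  have hLe : L ≤ atTop := inf_le_left
  -- From `n = 3` on, the truncated subtractions `n - 1`, `n - 2`, `n - 3` are genuine.
  have hev : ∀ᶠ n in L, ∃ m, n = m + 3 ∧ sturmianTerminal x (m + 3) = TwoVertices.one := by
    have h1 : ∀ᶠ n in L, 3 ≤ n := hLe (eventually_ge_atTop 3)
    have h2 : ∀ᶠ n in L, n ∈ M := mem_inf_of_right (mem_principal_self M)
    filter_upwards [h1, h2] with n h1 h2
    obtain ⟨m, rfl⟩ := Nat.exists_eq_add_of_le' h1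
    exact ⟨m, rfl, (hM1 _ h2).2⟩
  have hsub (j : ℕ) : Tendsto (fun n => n - j) L atTop := (tendsto_sub_atTop_nat j).mono_left hLe
  simp only [iterate_gaussMap_mass_ratio hd ha hrec] at hθ_lim
  have hw' := tendsto_cfSum_ratio hd (div_pos (ha 1) (ha 0)) hβ (hsub 3) (hsub 2) hw_lim
  have hw0 : 0 ≤ w := ge_of_tendsto' hw_lim fun n => by positivity
  have hθ1 : θ ≤ 1 := le_of_tendsto' hθ_lim fun n =>
    ((div_lt_one (ha _)).2 (mass_succ_lt hd ha hrec _)).le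
  have hg : Tendsto (fun n => 1 / (a (n - 2 + 1) / a (n - 2))) L (𝓝 (1 / θ)) :=
    tendsto_const_nhds.div hθ_lim hθ.ne'
  have hγ1 : 1 ≤ 1 / θ := (one_le_div hθ).2 hθ1
  have hden : 0 < 1 + θ * w := by positivity
  have hκ : 0 < θ / (1 + θ * w) := div_pos hθ hden
  have hB : Tendsto (fun n => cfSum d (n - 2) * a (n - 1)) L (𝓝 (θ / (1 + θ * w))) := by
    refine (hθ_lim.div ((hθ_lim.mul hw').const_add 1) hden.ne').congr' ?_
    filter_upwards [hev] with n hn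
    obtain ⟨m, rfl, -⟩ := hn
    have h1 := htot m
    have h2 := (ha (m + 1)).ne'
    have h3 := (cfSum_pos hd (m + 1)).ne'
    simp only [Pi.div_apply, Nat.add_sub_cancel, show m + 3 - 2 = m + 1 by omega,
      show m + 3 - 1 = m + 2 by omega]
    -- This is the total-mass identity `htot m` divided by `a (m + 1) * cfSum d (m + 1)`; it turns
    -- the quotient into `cfSum d (m + 1) * a (m + 2)`.
    have h4 : 1 + a (m + 1 + 1) / a (m + 1) * ((cfSum d m : ℝ) / cfSum d (m + 1)) =
        1 / (a (m + 1) * cfSum d (m + 1)) := by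
      field_simp
      linarith
    rw [h4]
    field_simp
  have hh₁' : h₁ = 1 - Int.fract (1 / θ) * (θ / (1 + θ * w)) := by
    rw [hh₁, Int.fract]
    field_simp
    ring
  have hh₂' : h₂ = h₁ + θ / (1 + θ * w) := by
    rw [hh₂, hh₁]
    ring
  have hρ0 := Int.fract_nonneg (1 / θ)
  have hρ1 := Int.fract_lt_one (1 / θ)
  have hh0 : 0 < h₁ := by
    have h1 : (1 : ℤ) ≤ ⌊1 / θ⌋ := Int.le_floor.2 (by exact_mod_cast hγ1)
    have h2 : (1 : ℝ) ≤ ⌊1 / θ⌋ := by exact_mod_cast h1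
    rw [hh₁]
    positivity
  -- At level `m + 3` the second slope of the law is `a (m + 3) / a (m + 2)`.
  have hr (m : ℕ) : Int.fract (1 / (a (m + 2) / a (m + 1))) = a (m + 3) / a (m + 2) :=
    gaussMap_mass_ratio hd ha hrec (m + 1)
  -- The left side is the height of the first tower times `μ(I)`, the first break at level `m + 3`;
  -- the total-mass identity puts it in the form `1 - ρ * B` of `tendsto_min_law`.
  have hA (m : ℕ) : cfSum d (m + 2) * a (m + 2) =
      1 - Int.fract (1 / (a (m + 2) / a (m + 1))) * (cfSum d (m + 1) * a (m + 2)) := by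
    have h1 := htot (m + 1)
    have h2 := (ha (m + 2)).ne'
    rw [hr]
    field_simp
    linarith
  refine ⟨⟨hh0, by nlinarith, by nlinarith, by linarith⟩,
    continuous_piecewiseLinearLaw hρ0 hρ1 hκ hh₁' hh₂' hh0, fun t => ?_, fun hθm => ?_⟩
  · rcases lt_or_ge t 0 with ht | ht
    · rw [piecewiseLinearLaw, if_pos ht.le]
      refine tendsto_const_nhds.congr' ?_
      filter_upwards [hev] with n hn
      obtain ⟨m, rfl, hm⟩ := hn
      refine (entranceLaw_of_neg ?_ ht).symm
      rw [measure_cylinder_of_terminal hmin hμ hm]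
      exact ha _
    · have hu := tendsto_floor_div_mul (L := L) (a := fun n => a (n - 1))
        (Eventually.of_forall fun n => ha _) ((tendsto_mass hd ha htot).comp (hsub 1)) ht
      rw [piecewiseLinearLaw_eq_min hρ0 hρ1 hκ hh₁' hh₂' hh0, max_eq_left ht, hh₁']
      refine (tendsto_min_law hg hB
        (Eventually.of_forall fun n => mul_nonneg (Nat.cast_nonneg _) (ha _).le) hu).congr' ?_
      filter_upwards [hev] with n hn
      obtain ⟨m, rfl, hm⟩ := hn
      rw [entranceLaw_cylinder hmin hμ (hd _ (by omega)) hm (ha _) ht]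
      simp only [show m + 3 - 2 = m + 1 by omega, show m + 3 - 1 = m + 2 by omega]
      rw [← hA, hr, ← ha_def]
      have h2 := (ha (m + 2)).ne'
      congr 3
      field_simp
  · have hf := tendsto_fract_of_ne_two_le hg (Eventually.of_forall fun n =>
      (one_le_div (div_pos (ha _) (ha _))).2
        ((div_lt_one (ha _)).2 (mass_succ_lt hd ha hrec _)).le) hγ1 hθm
    have hAlim := (hf.mul hB).const_sub 1
    rw [← hh₁'] at hAlim
    have hABlim := hAlim.add hB
    rw [← hh₂'] at hABlim
    refine ⟨hAlim.congr' ?_, hABlim.congr' ?_⟩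
    all_goals
      filter_upwards [hev] with n hn
      obtain ⟨m, rfl, hm⟩ := hn
      rw [measure_cylinder_of_terminal hmin hμ hm, ← ha_def]
      simp only [show m + 3 - 2 = m + 1 by omega, show m + 3 - 1 = m + 2 by omega]
      rw [← hA]
      simp only [cfSum]
      push_cast
      ring
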